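/- Let $\alpha_1,\alpha_2>1$, $H_1,H_2\in\mathbb R$, let $U_1,U_2\ge 1$ be integers, and let $X(\alpha_1^{n_1},\alpha_2^{n_2})$, $(n_1,n_2)\in\mathbb N_0^2$, be a (real or complex valued) second order random field on a probability space $(\Omega,P)$ which is wide-sense multi-scale invariant (MSI) with index $(H_1,H_2)$ and scale $(\alpha_1^{U_1},\alpha_2^{U_2})$ in each component: for $a=(\alpha_1^{U_1},1)$ and for $a=(1,\alpha_2^{U_2})$, and for all sampling points $s,t$, $$E[X(a\circ t)]=a_1^{H_1}a_2^{H_2}E[X(t)],\qquad E[X(a\circ s)\overline{X(a\circ t)}]=a_1^{2H_1}a_2^{2H_2}E[X(s)\overline{X(t)}],$$ where $a\circ t=(a_1t_1,a_2t_2)$. Put $D_{\mathbf U}=\{0,\dots,U_1-1\}\times\{0,\dots,U_2-1\}$, $\mathrm{Cov}(f,g)=E[(f-Ef)\overline{(g-Eg)}]$, $$Y(\mathbf n)=\alpha_1^{-n_1H_1}\alpha_2^{-n_2H_2}X(\alpha_1^{n_1},\alpha_2^{n_2}),\qquad Q_{\mathbf n}(\boldsymbol\tau)=\mathrm{Cov}(Y(\mathbf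 n),Y(\mathbf n+\boldsymbol\tau)),$$ $$Q^{\mathbf H}_{\mathbf m}(\boldsymbol\tau)=\mathrm{Cov}\big(X(\alpha_1^{m_1},\alpha_2^{m_2}),X(\alpha_1^{m_1+\tau_1},\alpha_2^{m_2+\tau_2})\big).$$ (If $\tau_1$ or $\tau_2$ is negative, $Q_{\mathbf n}(\boldsymbol\tau)$ means $\mathrm{Cov}(Y(\mathbf n'),Y(\mathbf n'+\boldsymbol\tau))$ with $n_i'=n_i+\max(-\tau_i,0)U_i$.) Then: (i) After enlarging the probability space by an independent random variable uniform on $[0,1]$, there is a countably additive $L^2$-valued random measure $\varphi$ carried by $[0,2\pi)^2$ such that, almost surely for every $(n_1,n_2)\in\mathbb N_0^2$, $$X(\alpha_1^{n_1},\alpha_2^{n_2})=\alpha_1^{n_1H_1}\alpha_2^{n_2H_2}\int_{[0,2\pi]^2}e^{-i(n_1\lambda_1+n_2\lambda_2)}\,\varphi(d\boldsymbol\lambda),$$ and $\varphi$ is the spectral random measure of a periodically correlated field of period $\mathbf U$: $F(A\times B)=E[\varphi(A)\overline{\varphi(B)}]$ defines a complex measure $F$ on pairs $(\boldsymbol\lambda,\boldsymbol\lambda')$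 in $[0,2\pi)^2\times[0,2\pi)^2$ which is carried by the union, over integers $|n_1|<U_1$, $|n_2|<U_2$, of the sets where $\boldsymbol\lambda-\boldsymbol\lambda'=2\pi(n_1/U_1,n_2/U_2)$. If the field is given and MSI in the same sense at all points $(\alpha_1^{n_1},\alpha_2^{n_2})$, $(n_1,n_2)\in\mathbb Z^2$, then no enlargement is needed, and the representation holds for all $(n_1,n_2)\in\mathbb Z^2$. (ii) For $\mathbf m\in\mathbb N_0^2$ and $\boldsymbol\tau\in\mathbb Z^2$ with $\mathbf m+\boldsymbol\tau\in\mathbb N_0^2$, $$Q^{\mathbf H}_{\mathbf m}(\boldsymbol\tau)=\alpha_1^{(2m_1+\tau_1)H_1}\alpha_2^{(2m_2+\tau_2)H_2}\sum_{(j_1,j_2)\in D_{\mathbf U}}e^{-2\pi i\left(\frac{m_1j_1}{U_1}+\frac{m_2j_2}{U_2}\right)}\mathcal R_{\mathbf j}(\boldsymbol\tau),$$ where $$\mathcal R_{\mathbf j}(\boldsymbol\tau)=\frac1{U_1U_2}\sum_{(n_1,n_2)\in D_{\mathbf U}}e^{2\pi i\left(\frac{n_1j_1}{U_1}+\frac{n_2j_2}{U_2}\right)}Q_{\mathbf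 n}(\boldsymbol\tau).$$ (iii) For $\mathbf j\in D_{\mathbf U}$ let the spectral density $d^{\mathbf H}_{\mathbf j}$ of the sampled field be defined from its covariance $Q^{\mathbf H}$ by $$d^{\mathbf H}_{\mathbf j}(\boldsymbol\lambda)=\frac1{4\pi^2}\sum_{\boldsymbol\tau\in D_{\mathbf U}}e^{i(\tau_1\lambda_1+\tau_2\lambda_2)}\,\frac1{U_1U_2}\sum_{\mathbf n\in D_{\mathbf U}}e^{2\pi i\left(\frac{n_1j_1}{U_1}+\frac{n_2j_2}{U_2}\right)}Q^{\mathbf H}_{\mathbf n}(\boldsymbol\tau).$$ Then for all $\boldsymbol\lambda\in\mathbb R^2$ (in particular on $[0,2\pi]^2$) $$d^{\mathbf H}_{\mathbf j}(\boldsymbol\lambda)=\frac1{(2\pi)^2}\sum_{(\tau_1,\tau_2)\in D_{\mathbf U}}e^{i(\lambda_1\tau_1+\lambda_2\tau_2)}\mathcal R^{\mathbf H}_{\mathbf j}(\boldsymbol\tau),$$ $$\mathcal R^{\mathbf H}_{\mathbf j}(\boldsymbol\tau)=\frac1{U_1U_2}\sum_{(n_1,n_2)\in D_{\mathbf U}}e^{2\pi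 i\left(\frac{n_1j_1}{U_1}+\frac{n_2j_2}{U_2}\right)}\alpha_1^{(2n_1+\tau_1)H_1}\alpha_2^{(2n_2+\tau_2)H_2}Q_{\mathbf n}(\boldsymbol\tau),$$ and for all $\mathbf n,\boldsymbol\tau\in D_{\mathbf U}$ $$Q^{\mathbf H}_{\mathbf n}(\boldsymbol\tau)=\sum_{\mathbf j\in D_{\mathbf U}}e^{-2\pi i\left(\frac{n_1j_1}{U_1}+\frac{n_2j_2}{U_2}\right)}\int_{[0,2\pi]^2}e^{-i(\tau_1\lambda_1+\tau_2\lambda_2)}d^{\mathbf H}_{\mathbf j}(\boldsymbol\lambda)\,d\boldsymbol\lambda.$$ -/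

import Mathlib

open MeasureTheory Filter Topology

noncomputable section

namespace MSI

variable {Ω : Type*} [MeasurableSpace Ω]

/-! ### Second order fields and multi-scale invariance -/

/-- Covariance `Cov(f, g) = E[(f - E f) conj(g - E g)]` of complex (in particular real) random
variables. -/
def ccov (P : Measure Ω) (f g : Ω → ℂ) : ℂ :=
  ∫ ω, (f ω - ∫ x, f x ∂P) * starRingEnd ℂ (g ω - ∫ x, g x ∂P) ∂P

/-- Coordinatewise (Hadamard) product of two points of the plane. -/
def hadamard (a t : ℝ × ℝ) : ℝ × ℝ := (a.1 * t.1, a.2 * t.2)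

/-- The field `X`, with parameter space `T`, satisfies the wide-sense scaling relations of index
`H` for the dilation by `a`: means scale by `a₁^H₁ a₂^H₂` and second order moments by
`a₁^(2H₁) a₂^(2H₂)`. -/
structure ScalesBy (P : Measure Ω) (T : Set (ℝ × ℝ)) (H a : ℝ × ℝ) (X : ℝ × ℝ → Ω → ℂ) :
    Prop where
  mean : ∀ t ∈ T, hadamard a t ∈ T →
    ∫ ω, X (hadamard a t) ω ∂P = ((a.1 ^ H.1 * a.2 ^ H.2 : ℝ) : ℂ) * ∫ ω, X t ω ∂P
  moment : ∀ s ∈ T, ∀ t ∈ T, hadamard a s ∈ T → hadamard a t ∈ T →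
    ∫ ω, X (hadamard a s) ω * starRingEnd ℂ (X (hadamard a t) ω) ∂P =
      ((a.1 ^ (2 * H.1) * a.2 ^ (2 * H.2) : ℝ) : ℂ) *
        ∫ ω, X s ω * starRingEnd ℂ (X t ω) ∂P

/-- The field `X` with parameter space `T` is (wide-sense) multi-scale invariant of index `H` and
scale `a`: it is of second order and has the discrete scale invariance property in each
component. Composing the two relations gives the one for the dilation by `a` itself. -/
structure IsMSI (P : Measure Ω) (T : Set (ℝ × ℝ)) (H a : ℝ × ℝ) (X : ℝ × ℝ → Ω → ℂ) : Prop where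
  memLp : ∀ t ∈ T, MemLp (X t) 2 P
  scale_fst : ScalesBy P T H (a.1, 1) X
  scale_snd : ScalesBy P T H (1, a.2) X

/-- The sampling point `(α₁^n₁, α₂^n₂)`. -/
def samplePoint (α : ℝ × ℝ) (n : ℤ × ℤ) : ℝ × ℝ := (α.1 ^ n.1, α.2 ^ n.2)

/-- The factor `α₁^(k₁ H₁) α₂^(k₂ H₂)`. -/
def scaleFactor (α H : ℝ × ℝ) (k : ℤ × ℤ) : ℝ := α.1 ^ (k.1 * H.1) * α.2 ^ (k.2 * H.2)

/-- The inverse quasi-Lamperti transform of `X` at the lattice points: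
`Y(n) = α₁^(-n₁H₁) α₂^(-n₂H₂) X(α₁^n₁, α₂^n₂)`. -/
def lampertiInv (α H : ℝ × ℝ) (X : ℝ × ℝ → Ω → ℂ) (n : ℤ × ℤ) (ω : Ω) : ℂ :=
  (scaleFactor α H (-n) : ℂ) * X (samplePoint α n) ω

/-- `Q^H_m(τ) = Cov(X(α^m), X(α^(m+τ)))`. -/
def sampledCov (P : Measure Ω) (α : ℝ × ℝ) (X : ℝ × ℝ → Ω → ℂ) (m τ : ℤ × ℤ) : ℂ :=
  ccov P (X (samplePoint α m)) (X (samplePoint α (m + τ)))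

/-- The multiple `((-τ₁)⁺ U₁, (-τ₂)⁺ U₂)` of the period. It is zero when `τ` has nonnegative
coordinates. -/
def periodShift (U : ℕ × ℕ) (τ : ℤ × ℤ) : ℤ × ℤ :=
  (max (-τ.1) 0 * U.1, max (-τ.2) 0 * U.2)

/-- `Q_n(τ) = Cov(Y(n), Y(n+τ))` for a field `Y` on the nonnegative quadrant whose covariance has
period `U`. The pair `(n, n+τ)` is moved by `periodShift U τ`: this is no change if `τ` has
nonnegative coordinates, and otherwise it makes both indices nonnegative. -/
def periodicCov (P : Measure Ω) (U : ℕ × ℕ) (Y : ℤ × ℤ → Ω → ℂ) (n τ : ℤ × ℤ) : ℂ :=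
  ccov P (Y (n + periodShift U τ)) (Y (n + periodShift U τ + τ))

/-! ### Finite Fourier sums -/

/-- `D_U = {0, …, U₁ - 1} × {0, …, U₂ - 1}`. -/
def box (U : ℕ × ℕ) : Finset (ℤ × ℤ) :=
  Finset.Ico (0 : ℤ) U.1 ×ˢ Finset.Ico (0 : ℤ) U.2

/-- `e^{2πi (n₁j₁/U₁ + n₂j₂/U₂)}`. -/
def boxChar (U : ℕ × ℕ) (n j : ℤ × ℤ) : ℂ :=
  Complex.exp (2 * Real.pi * Complex.I * (n.1 * j.1 / U.1 + n.2 * j.2 / U.2))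

/-- `e^{i (τ₁l₁ + τ₂l₂)}`. -/
def wave (τ : ℤ × ℤ) (l : ℝ × ℝ) : ℂ :=
  Complex.exp (Complex.I * (τ.1 * l.1 + τ.2 * l.2))

/-- The auxiliary functions attached to a covariance `Q_n(τ)`:
`R_j(τ) = (U₁U₂)⁻¹ ∑_{n ∈ D_U} e^{2πi (n₁j₁/U₁ + n₂j₂/U₂)} Q_n(τ)`. -/
def auxR (U : ℕ × ℕ) (Q : ℤ × ℤ → ℤ × ℤ → ℂ) (j τ : ℤ × ℤ) : ℂ :=
  1 / ((U.1 : ℂ) * U.2) * ∑ n ∈ box U, boxChar U n j * Q n τ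

/-- The spectral density attached to a covariance `Q_n(τ)`:
`d_j(l) = (4π²)⁻¹ ∑_{τ ∈ D_U} e^{i (τ₁l₁ + τ₂l₂)} R_j(τ)`. -/
def spectralDensity (U : ℕ × ℕ) (Q : ℤ × ℤ → ℤ × ℤ → ℂ) (j : ℤ × ℤ) (l : ℝ × ℝ) : ℂ :=
  1 / (4 * (Real.pi : ℂ) ^ 2) * ∑ τ ∈ box U, wave τ l * auxR U Q j τ

/-! ### Random spectral measures and their integrals -/

/-- The square `[0, 2π]²`. -/
def square : Set (ℝ × ℝ) := Set.Icc 0 (2 * Real.pi) ×ˢ Set.Icc 0 (2 * Real.pi)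

/-- The half-open square `[0, 2π)²`. -/
def halfOpenSquare : Set (ℝ × ℝ) := Set.Ico 0 (2 * Real.pi) ×ˢ Set.Ico 0 (2 * Real.pi)

section Integral

variable {β E : Type*} [MeasurableSpace β] [NormedAddCommGroup E] [NormedSpace ℂ E]

/-- The integral over `K` of a simple function against a vector measure. -/
def simpleIntegral (μ : VectorMeasure β E) (K : Set β) (s : SimpleFunc β ℂ) : E :=
  ∑ c ∈ s.range, c • μ (s ⁻¹' {c} ∩ K)

/-- `∫_K f dμ = I` for a vector measure `μ`, which may have infinite variation, and a function `f`
that is a uniform limit on `K` of simple functions (that is, `f` is bounded and measurable on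
`K`): such simple functions exist, and the integrals of any of them tend to `I`. -/
structure HasIntegralOn (μ : VectorMeasure β E) (K : Set β) (f : β → ℂ) (I : E) : Prop where
  approx : ∃ s : ℕ → SimpleFunc β ℂ, TendstoUniformlyOn (fun k x => s k x) f atTop K
  tendsto : ∀ s : ℕ → SimpleFunc β ℂ, TendstoUniformlyOn (fun k x => s k x) f atTop K →
    Tendsto (fun k => simpleIntegral μ K (s k)) atTop (𝓝 I)

end Integral

/-- `S_n = {(l, l') ∈ [0, 2π)² × [0, 2π)² : l - l' = 2π (n₁/U₁, n₂/U₂)}`. -/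
def diagonalSet (U : ℕ × ℕ) (n : ℤ × ℤ) : Set ((ℝ × ℝ) × (ℝ × ℝ)) :=
  {p | p.1 ∈ halfOpenSquare ∧ p.2 ∈ halfOpenSquare ∧
    p.1.1 - p.2.1 = 2 * Real.pi * n.1 / U.1 ∧ p.1.2 - p.2.2 = 2 * Real.pi * n.2 / U.2}

/-- `φ` is the spectral random measure of a periodically correlated field of period `U`: a
countably additive measure on the plane with values in `L²(P)`, carried by `[0, 2π)²`, whose
spectral distribution `F(dl, dl') = E[φ(dl) conj φ(dl')]` is a complex measure carried by the
sets `S_n` with `|n₁| < U₁` and `|n₂| < U₂`. In particular `φ` has orthogonal increments on each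
of the `U₁U₂` half-open blocks of sides `2π/U₁` and `2π/U₂`. -/
structure IsSpectralRandomMeasure (P : Measure Ω) (U : ℕ × ℕ)
    (φ : VectorMeasure (ℝ × ℝ) (Lp ℂ 2 P)) : Prop where
  carried : ∀ A, MeasurableSet A → Disjoint A halfOpenSquare → φ A = 0
  spectral : ∃ F : ComplexMeasure ((ℝ × ℝ) × (ℝ × ℝ)),
    (∀ A B, MeasurableSet A → MeasurableSet B →
      F (A ×ˢ B) = ∫ ω, φ A ω * starRingEnd ℂ (φ B ω) ∂P) ∧
    ∀ C, MeasurableSet C →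
      (∀ n : ℤ × ℤ, |n.1| < U.1 → |n.2| < U.2 → Disjoint C (diagonalSet U n)) → F C = 0

/-- `φ` represents the field `Z(n)`, `n ∈ N`: almost surely
`Z(n) = α₁^(n₁H₁) α₂^(n₂H₂) ∫_{[0,2π]²} e^{-i (n₁l₁ + n₂l₂)} φ(dl)`. -/
def HarmonicRepr (P : Measure Ω) (α H : ℝ × ℝ) (N : Set (ℤ × ℤ)) (Z : ℤ × ℤ → Ω → ℂ)
    (φ : VectorMeasure (ℝ × ℝ) (Lp ℂ 2 P)) : Prop :=
  ∀ n ∈ N, ∃ I : Lp ℂ 2 P, HasIntegralOn φ square (wave (-n)) I ∧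
    Z n =ᵐ[P] fun ω => (scaleFactor α H n : ℂ) * I ω

end MSI

end

/-! Scale invariance of `X` says exactly that `Y`, the inverse quasi-Lamperti transform, has means
and second moments invariant under n ↦ n + U₁e₁ and n ↦ n + U₂e₂: the powers of α in the
normalization cancel those in the scaling law. So `Y` is periodically correlated, and (i) is a
spectral theorem for such fields.

Over ℤ², write n = r + kU with r in the box. The U₁U₂ fields k ↦ Y(r + kU) are jointly stationary,
so the index shifts are commuting unitaries on their closed span (`exists_torus_shift`), and Gelfand
duality turns these into a representation Ψ of C(𝕋²). Riesz–Markov applied to f ↦ ∑_r ⟨y_r, Ψ(f)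
y_r⟩ gives one finite measure μ that controls all components: f ↦ Ψ(f) y_r extends to a bounded Φ_r
on L²(μ), and the inner products of the Φ_r have densities h_{rs}
(`exists_stationary_representation`). For z in 𝕋² let λ_j(z) be the point of block j of [0, 2π)²
with e^{-iUλ} = z coordinatewise, and put φ(A) = (U₁U₂)⁻¹ ∑_{r,j} Φ_r(1_A(λ_j) e^{i r·λ_j}). Then ∫
e^{-in·λ} dφ involves ∑_j e^{i(r-n)·λ_j}, which vanishes unless r ≡ n mod U and otherwise equals
U₁U₂ z^k, so the integral is Φ_r(z^k) = Y(n) (`exists_harmonic_measure`). The spectral distribution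
is a sum of pushforwards under z ↦ (λ_i(z), λ_j(z)), whose two entries differ by 2π(i - j)/U; hence
its support.

On the quadrant the shifts need not be invertible, so the field is first extended to ℤ². Periodicity
extends the moment kernel, positivity survives because finitely many indices can be moved into the
quadrant together, and the new vectors are placed in L²(P × [0,1]) using the room supplied by the
functions e^{2πi(k+1)t}, which are orthogonal to everything depending on ω alone
(`exists_lattice_extension`).

Part (ii) is Fourier inversion on ℤ/U₁ × ℤ/U₂ together with periodicity of the covariance of `Y`.
Part (iii) is the covariance relation between `X` and `Y`, the same inversion, and orthogonality of
exponentials on the square. -/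

noncomputable section

namespace MSI

/-! ### The torus and joint functional calculus of two commuting unitaries -/

/-- The two-dimensional torus `{(z₁, z₂) : |z₁| = |z₂| = 1}`. -/
abbrev Torus : Type := Metric.sphere (0 : ℂ) 1 × Metric.sphere (0 : ℂ) 1

/-- The first coordinate function of the torus. -/
def torusFst : C(Torus, ℂ) := ⟨fun z => z.1, by fun_prop⟩

/-- The second coordinate function of the torus. -/
def torusSnd : C(Torus, ℂ) := ⟨fun z => z.2, by fun_prop⟩

open WeakDual in
theorem norm_character_of_mem_unitary {A : Type*} [CommCStarAlgebra A] {u : A}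
    (hu : u ∈ unitary A) (χ : characterSpace ℂ A) : ‖χ u‖ = 1 := by
  have h : χ (star u * u) = 1 := by rw [(Unitary.mem_iff.1 hu).1, map_one]
  rw [map_mul, map_star, ← starRingEnd_apply, ← Complex.normSq_eq_conj_mul_self] at h
  have h2 : Complex.normSq (χ u) = 1 := by exact_mod_cast h
  rw [Complex.normSq_eq_norm_sq] at h2
  nlinarith [norm_nonneg (χ u)]

-- Characters take values of modulus one on unitaries, so χ ↦ (χ u, χ v) maps the character space
-- continuously into the torus. The homomorphism is pullback along this map followed by the inverse
-- Gelfand transform.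
open WeakDual in
theorem exists_torus_starAlgHom_of_comm {A : Type*} [CommCStarAlgebra A] {u v : A}
    (hu : u ∈ unitary A) (hv : v ∈ unitary A) :
    ∃ Ψ : C(Torus, ℂ) →⋆ₐ[ℂ] A, Ψ torusFst = u ∧ Ψ torusSnd = v := by
  let p : C(characterSpace ℂ A, Torus) :=
    ⟨fun χ => (⟨χ u, by simpa using norm_character_of_mem_unitary hu χ⟩,
      ⟨χ v, by simpa using norm_character_of_mem_unitary hv χ⟩), by
      refine Continuous.prodMk (Continuous.subtype_mk ?_ _) (Continuous.subtype_mk ?_ _)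
      · exact (gelfandTransform ℂ A u).continuous
      · exact (gelfandTransform ℂ A v).continuous⟩
  refine ⟨((gelfandStarTransform A).symm : C(characterSpace ℂ A, ℂ) →⋆ₐ[ℂ] A).comp
    (p.compStarAlgHom' ℂ ℂ), ?_, ?_⟩
  · change (gelfandStarTransform A).symm (torusFst.comp p) = u
    rw [StarAlgEquiv.symm_apply_eq]
    ext χ
    rfl
  · change (gelfandStarTransform A).symm (torusSnd.comp p) = v
    rw [StarAlgEquiv.symm_apply_eq]
    ext χ
    rfl

/-- Reduction to the commutative case: u commutes with v and, v being unitary, with `star v`, so the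
closed star subalgebra generated by u and v is commutative. -/
theorem exists_torus_starAlgHom {A : Type*} [CStarAlgebra A] {u v : A}
    (hu : u ∈ unitary A) (hv : v ∈ unitary A) (huv : Commute u v) :
    ∃ Ψ : C(Torus, ℂ) →⋆ₐ[ℂ] A, Ψ torusFst = u ∧ Ψ torusSnd = v := by
  let S : StarSubalgebra ℂ A := StarAlgebra.adjoin ℂ {u, v}
  have huv' : Commute u (star v) := by
    calc u * star v = star v * (v * u) * star v := by
          rw [← mul_assoc, (Unitary.mem_iff.1 hv).1, one_mul]
      _ = star v * u * (v * star v) := by rw [← huv.eq]; simp only [mul_assoc]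
      _ = star v * u := by rw [(Unitary.mem_iff.1 hv).2, mul_one]
  have hS : IsMulCommutative S := by
    refine StarAlgebra.isMulCommutative_adjoin ℂ ?_ ?_
    · rintro x (rfl | rfl) y (rfl | rfl)
      exacts [rfl, huv, huv.symm, rfl]
    · have h1 := Unitary.mem_iff.1 hu
      have h2 := Unitary.mem_iff.1 hv
      rintro x (rfl | rfl) y (rfl | rfl)
      · rw [h1.1, h1.2]
      · exact huv'
      · have h := huv'.star_star
        rw [star_star] at h
        exact h.symm.eq
      · rw [h2.1, h2.2]
  let T := S.topologicalClosure
  have hT : IsClosed (T : Set A) := S.isClosed_topologicalClosure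
  let _ : CommCStarAlgebra T :=
    { StarSubalgebra.cstarAlgebra T with
      mul_comm := (S.commRingTopologicalClosure fun x y => mul_comm' x y).mul_comm }
  have huS : u ∈ T := S.le_topologicalClosure (StarAlgebra.subset_adjoin ℂ _ (by simp))
  have hvS : v ∈ T := S.le_topologicalClosure (StarAlgebra.subset_adjoin ℂ _ (by simp))
  obtain ⟨Ψ, h1, h2⟩ := exists_torus_starAlgHom_of_comm (A := T) (u := ⟨u, huS⟩) (v := ⟨v, hvS⟩)
    (Unitary.mem_iff.2 ⟨Subtype.ext (Unitary.mem_iff.1 hu).1, Subtype.ext (Unitary.mem_iff.1 hu).2⟩)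
    (Unitary.mem_iff.2 ⟨Subtype.ext (Unitary.mem_iff.1 hv).1, Subtype.ext (Unitary.mem_iff.1 hv).2⟩)
  refine ⟨T.subtype.comp Ψ, ?_, ?_⟩
  · simp [h1]
  · simp [h2]

/-! ### Isometries determined by a Gram matrix -/

section Gram

variable {κ E F : Type*} [NormedAddCommGroup E] [InnerProductSpace ℂ E]
  [NormedAddCommGroup F] [InnerProductSpace ℂ F]

theorem norm_linearCombination_eq_of_inner_eq {u : κ → E} {v : κ → F}
    (h : ∀ a b, inner ℂ (u a) (u b) = inner ℂ (v a) (v b)) (c : κ →₀ ℂ) :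
    ‖Finsupp.linearCombination ℂ v c‖ = ‖Finsupp.linearCombination ℂ u c‖ := by
  have key : inner ℂ (Finsupp.linearCombination ℂ v c) (Finsupp.linearCombination ℂ v c) =
      inner ℂ (Finsupp.linearCombination ℂ u c) (Finsupp.linearCombination ℂ u c) := by
    simp only [Finsupp.linearCombination_apply, Finsupp.sum, sum_inner, inner_sum,
      inner_smul_left, inner_smul_right, h]
  rw [inner_self_eq_norm_sq_to_K, inner_self_eq_norm_sq_to_K] at key
  have key' : ‖Finsupp.linearCombination ℂ v c‖ ^ 2 = ‖Finsupp.linearCombination ℂ u c‖ ^ 2 := by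
    exact_mod_cast key
  exact (pow_left_inj₀ (norm_nonneg _) (norm_nonneg _) two_ne_zero).1 key'

/-- Equal Gram matrices give corresponding linear combinations equal norms. The correspondence is
therefore well defined on the span, even when the family is linearly dependent, and extends by
density. -/
theorem exists_linearIsometry_of_inner_eq [CompleteSpace F] {u : κ → E} {v : κ → F}
    (hu : Dense (Submodule.span ℂ (Set.range u) : Set E))
    (h : ∀ a b, inner ℂ (u a) (u b) = inner ℂ (v a) (v b)) :
    ∃ V : E →ₗᵢ[ℂ] F, ∀ a, V (u a) = v a := by
  let e : (κ →₀ ℂ) →ₗ[ℂ] E := Finsupp.linearCombination ℂ u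
  let f : (κ →₀ ℂ) →ₗ[ℂ] F := Finsupp.linearCombination ℂ v
  have hd : DenseRange e := by
    rw [DenseRange, ← LinearMap.coe_range, Finsupp.range_linearCombination]
    exact hu
  have hn : ∀ c, ‖f c‖ = ‖e c‖ := norm_linearCombination_eq_of_inner_eq h
  have hb : ∃ C, ∀ c, ‖f c‖ ≤ C * ‖e c‖ := ⟨1, fun c => by rw [one_mul, hn]⟩
  refine ⟨⟨(f.extendOfNorm e).toLinearMap, fun x => ?_⟩, fun a => ?_⟩
  · induction x using hd.induction_on with
    | hp => exact isClosed_eq (by simp only [ContinuousLinearMap.coe_coe]; fun_prop) (by fun_prop)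
    | ih c =>
      rw [ContinuousLinearMap.coe_coe, LinearMap.extendOfNorm_eq hd hb, hn]
  · have : (f.extendOfNorm e) (e (Finsupp.single a 1)) = f (Finsupp.single a 1) :=
      LinearMap.extendOfNorm_eq hd hb _
    simpa [e, f] using this

end Gram

/-! ### Cyclic representations of `C(X)` -/

section Representation

variable {X H ι : Type*} [TopologicalSpace X]
  [NormedAddCommGroup H] [InnerProductSpace ℂ H] [CompleteSpace H]

theorem inner_starAlgHom_star_mul (Ψ : C(X, ℂ) →⋆ₐ[ℂ] (H →L[ℂ] H)) (f g : C(X, ℂ)) (x y : H) :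
    inner ℂ (Ψ f x) (Ψ g y) = inner ℂ x (Ψ (star f * g) y) := by
  rw [map_mul, map_star, ContinuousLinearMap.star_eq_adjoint]
  exact (ContinuousLinearMap.adjoint_inner_right _ _ _).symm

/-- A real continuous function as a complex one. -/
def ofRealMap (u : C(X, ℝ)) : C(X, ℂ) := ⟨fun x => (u x : ℂ), by fun_prop⟩

variable [Fintype ι]

/-- With s = √(v - u), each summand grows by ‖Ψ(s) x‖². This is the positivity required by
Riesz–Markov. -/
theorem sum_re_inner_mono (Ψ : C(X, ℂ) →⋆ₐ[ℂ] (H →L[ℂ] H)) (x : ι → H) {u v : C(X, ℝ)}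
    (huv : u ≤ v) : ∑ i, (inner ℂ (x i) (Ψ (ofRealMap u) (x i))).re ≤
      ∑ i, (inner ℂ (x i) (Ψ (ofRealMap v) (x i))).re := by
  refine Finset.sum_le_sum fun i _ => ?_
  let s : C(X, ℂ) := ⟨fun z => (Real.sqrt (v z - u z) : ℂ), by fun_prop⟩
  have hs : ofRealMap v = ofRealMap u + star s * s := by
    ext z
    simp only [ofRealMap, s, ContinuousMap.coe_mk, ContinuousMap.add_apply, ContinuousMap.mul_apply,
      ContinuousMap.star_apply, Complex.star_def, Complex.conj_ofReal]
    rw [← Complex.ofReal_mul, Real.mul_self_sqrt (show 0 ≤ v z - u z from sub_nonneg.2 (huv z))]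
    push_cast
    ring
  rw [hs, map_add, add_apply, inner_add_right, Complex.add_re,
    ← inner_starAlgHom_star_mul]
  have := @inner_self_nonneg ℂ H _ _ _ (Ψ s (x i))
  simp only [RCLike.re_to_complex] at this
  linarith

variable [CompactSpace X] [MeasurableSpace X] [BorelSpace X]

/-- Summing over the family produces a single measure that dominates the diagonal spectral measure
of every vector. -/
theorem exists_measure_sum_inner [T2Space X] (Ψ : C(X, ℂ) →⋆ₐ[ℂ] (H →L[ℂ] H)) (x : ι → H) :
    ∃ μ : Measure X, μ.Regular ∧ IsFiniteMeasure μ ∧ ∀ u : C(X, ℝ),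
      ∫ z, u z ∂μ = ∑ i, (inner ℂ (x i) (Ψ (ofRealMap u) (x i))).re := by
  let Λ : CompactlySupportedContinuousMap X ℝ →ₚ[ℝ] ℝ :=
    { toFun := fun u => ∑ i, (inner ℂ (x i) (Ψ (ofRealMap u.toContinuousMap) (x i))).re
      map_add' := fun u v => by
        rw [← Finset.sum_add_distrib]
        refine Finset.sum_congr rfl fun i _ => ?_
        have : ofRealMap (u + v).toContinuousMap =
            ofRealMap u.toContinuousMap + ofRealMap v.toContinuousMap := by
          ext z; simp [ofRealMap]
        rw [this, map_add, add_apply, inner_add_right, Complex.add_re]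
      map_smul' := fun c u => by
        rw [RingHom.id_apply, Finset.smul_sum]
        refine Finset.sum_congr rfl fun i _ => ?_
        have : ofRealMap (c • u).toContinuousMap = (c : ℂ) • ofRealMap u.toContinuousMap := by
          ext z; simp [ofRealMap]
        rw [this, map_smul, smul_apply, inner_smul_right,
          Complex.re_ofReal_mul, smul_eq_mul]
      monotone' := fun u v huv => sum_re_inner_mono Ψ x huv }
  refine ⟨RealRMK.rieszMeasure Λ, inferInstance, inferInstance, fun u => ?_⟩
  exact RealRMK.integral_rieszMeasure Λ ⟨u, HasCompactSupport.of_compactSpace _⟩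

/-- ‖Ψ(f) x_i‖² = ⟨x_i, Ψ(|f|²) x_i⟩ is one of the nonnegative terms whose sum is ∫ |f|² dμ. -/
theorem norm_starAlgHom_apply_le {Ψ : C(X, ℂ) →⋆ₐ[ℂ] (H →L[ℂ] H)} {x : ι → H} {μ : Measure X}
    [IsFiniteMeasure μ] (hμ : ∀ u : C(X, ℝ),
      ∫ z, u z ∂μ = ∑ i, (inner ℂ (x i) (Ψ (ofRealMap u) (x i))).re) (i : ι) (f : C(X, ℂ)) :
    ‖Ψ f (x i)‖ ≤ ‖ContinuousMap.toLp 2 μ ℂ f‖ := by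
  let u : C(X, ℝ) := ⟨fun z => Complex.normSq (f z), Complex.continuous_normSq.comp f.continuous⟩
  have hu : ofRealMap u = star f * f := by
    ext z
    simp [ofRealMap, u, Complex.normSq_eq_conj_mul_self]
  have h1 : ∀ j, (inner ℂ (x j) (Ψ (ofRealMap u) (x j))).re = ‖Ψ f (x j)‖ ^ 2 := fun j => by
    rw [hu, ← inner_starAlgHom_star_mul, inner_self_eq_norm_sq_to_K]
    norm_cast
  have h2 : ‖ContinuousMap.toLp 2 μ ℂ f‖ ^ 2 = ∫ z, u z ∂μ := by
    have h := ContinuousMap.inner_toLp (𝕜 := ℂ) μ f f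
    rw [inner_self_eq_norm_sq_to_K] at h
    have h' : ∀ z, f z * starRingEnd ℂ (f z) = ((u z : ℝ) : ℂ) := fun z => by
      simp [u, Complex.mul_conj]
    simp_rw [h'] at h
    rw [integral_complex_ofReal] at h
    exact Complex.ofReal_injective (by rw [Complex.ofReal_pow]; exact h)
  rw [← sq_le_sq₀ (norm_nonneg _) (norm_nonneg _), h2, hμ]
  simp_rw [h1]
  exact Finset.single_le_sum (f := fun j => ‖Ψ f (x j)‖ ^ 2) (fun j _ => by positivity)
    (Finset.mem_univ i)

end Representation

theorem inner_toLp_toLp {X : Type*} [MeasurableSpace X] {μ : Measure X} {f g : X → ℂ}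
    (hf : MemLp f 2 μ) (hg : MemLp g 2 μ) :
    inner ℂ (hf.toLp f) (hg.toLp g) = ∫ z, starRingEnd ℂ (f z) * g z ∂μ := by
  rw [L2.inner_def]
  refine integral_congr_ae ?_
  filter_upwards [hf.coeFn_toLp, hg.coeFn_toLp] with z h1 h2
  rw [h1, h2, RCLike.inner_apply, mul_comm]

section Representation

variable {X H : Type*} [TopologicalSpace X] [CompactSpace X] [MeasurableSpace X]
  [BorelSpace X] [NormedAddCommGroup H] [InnerProductSpace ℂ H] [CompleteSpace H]

theorem memLp_continuousMap (μ : Measure X) [IsFiniteMeasure μ] (p : ENNReal) (f : C(X, ℂ)) :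
    MemLp f p μ :=
  (memLp_top_of_bound f.continuous.aestronglyMeasurable ‖f‖
    (ae_of_all _ f.norm_coe_le_norm)).mono_exponent le_top

theorem continuousMap_toLp_eq (μ : Measure X) [IsFiniteMeasure μ] (f : C(X, ℂ)) :
    ContinuousMap.toLp 2 μ ℂ f = (memLp_continuousMap μ 2 f).toLp f := by
  apply Lp.ext
  filter_upwards [ContinuousMap.coeFn_toLp (p := 2) (𝕜 := ℂ) μ f,
    (memLp_continuousMap μ 2 f).coeFn_toLp] with z h1 h2
  rw [h1, h2]

variable [T2Space X]

/-- The integrals of a representation of `C(X)` at two vectors have a cross density. -/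
theorem exists_cross_density {Ψ : C(X, ℂ) →⋆ₐ[ℂ] (H →L[ℂ] H)} {μ : Measure X} [μ.Regular]
    [IsFiniteMeasure μ] {x y : H} {Φ Φ' : Lp ℂ 2 μ →L[ℂ] H}
    (hΦ : ∀ f, Φ (ContinuousMap.toLp 2 μ ℂ f) = Ψ f x)
    (hΦ' : ∀ f, Φ' (ContinuousMap.toLp 2 μ ℂ f) = Ψ f y) :
    ∃ h : X → ℂ, MemLp h 2 μ ∧ ∀ (f g : X → ℂ) (hf : MemLp f 2 μ) (hg : MemLp g 2 μ),
      MemLp g ⊤ μ →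
      inner ℂ (Φ' (hg.toLp g)) (Φ (hf.toLp f)) = ∫ z, starRingEnd ℂ (g z) * f z * h z ∂μ := by
  -- `S` intertwines multiplication by continuous functions, so it acts on them as multiplication by
  -- S(1), which is the density sought.
  let S : Lp ℂ 2 μ →L[ℂ] Lp ℂ 2 μ := (ContinuousLinearMap.adjoint Φ').comp Φ
  have hS : ∀ F G, inner ℂ G (S F) = inner ℂ (Φ' G) (Φ F) := fun F G => by
    simp only [S, ContinuousLinearMap.comp_apply, ContinuousLinearMap.adjoint_inner_right]
  have hd : DenseRange (ContinuousMap.toLp 2 μ ℂ : C(X, ℂ) →L[ℂ] Lp ℂ 2 μ) :=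
    ContinuousMap.toLp_denseRange ℂ μ ℂ (by simp)
  let h : Lp ℂ 2 μ := S (ContinuousMap.toLp 2 μ ℂ 1)
  have hh : MemLp h 2 μ := Lp.memLp h
  have hh' : hh.toLp h = h := Lp.toLp_coeFn h hh
  have hfh : ∀ f : C(X, ℂ), MemLp (fun z => f z * h z) 2 μ := fun f =>
    hh.mul (memLp_continuousMap μ ⊤ f)
  have step : ∀ f : C(X, ℂ), S (ContinuousMap.toLp 2 μ ℂ f) = (hfh f).toLp _ := fun f => by
    refine hd.eq_of_inner_right ℂ fun g => ?_
    have e : inner ℂ (ContinuousMap.toLp 2 μ ℂ g) (S (ContinuousMap.toLp 2 μ ℂ f)) =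
        inner ℂ (ContinuousMap.toLp 2 μ ℂ (star f * g)) (hh.toLp h) := by
      rw [hh', hS, hS, hΦ, hΦ, hΦ', hΦ', inner_starAlgHom_star_mul, inner_starAlgHom_star_mul]
      congr 3
      rw [star_mul, star_star, mul_one]
    rw [e, continuousMap_toLp_eq, continuousMap_toLp_eq, inner_toLp_toLp, inner_toLp_toLp]
    refine integral_congr_ae (ae_of_all _ fun z => ?_)
    simp only [ContinuousMap.mul_apply, ContinuousMap.star_apply, Complex.star_def, map_mul,
      Complex.conj_conj]
    ring
  refine ⟨h, hh, fun f g hf hg hg' => ?_⟩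
  -- Boundedness of g enters here: h is only known to be square integrable.
  have hgh : MemLp (fun z => g z * starRingEnd ℂ (h z)) 2 μ := hh.star.mul hg'
  have key : ∀ F : Lp ℂ 2 μ, inner ℂ (hg.toLp g) (S F) = inner ℂ (hgh.toLp _) F := fun F => by
    induction F using hd.induction_on with
    | hp => exact isClosed_eq (by fun_prop) (by fun_prop)
    | ih f =>
      rw [step, continuousMap_toLp_eq, inner_toLp_toLp, inner_toLp_toLp]
      refine integral_congr_ae (ae_of_all _ fun z => ?_)
      simp only [map_mul, Complex.conj_conj]
      ring
  rw [← hS, key, inner_toLp_toLp]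
  refine integral_congr_ae (ae_of_all _ fun z => ?_)
  simp only [map_mul, Complex.conj_conj]
  ring

theorem exists_L2_representation {ι : Type*} [Fintype ι] (Ψ : C(X, ℂ) →⋆ₐ[ℂ] (H →L[ℂ] H))
    (x : ι → H) : ∃ μ : Measure X, μ.Regular ∧ IsFiniteMeasure μ ∧
      ∃ Φ : ι → Lp ℂ 2 μ →L[ℂ] H,
        (∀ i (f : C(X, ℂ)) (hf : MemLp f 2 μ), Φ i (hf.toLp f) = Ψ f (x i)) ∧
        ∃ h : ι → ι → X → ℂ, (∀ i j, MemLp (h i j) 2 μ) ∧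
          ∀ i j (f g : X → ℂ) (hf : MemLp f 2 μ) (hg : MemLp g 2 μ), MemLp g ⊤ μ →
            inner ℂ (Φ j (hg.toLp g)) (Φ i (hf.toLp f)) =
              ∫ z, starRingEnd ℂ (g z) * f z * h i j z ∂μ := by
  obtain ⟨μ, hr, hfin, hμ⟩ := exists_measure_sum_inner Ψ x
  have hd : DenseRange (ContinuousMap.toLp 2 μ ℂ : C(X, ℂ) →L[ℂ] Lp ℂ 2 μ) :=
    ContinuousMap.toLp_denseRange ℂ μ ℂ (by simp)
  let L : ι → C(X, ℂ) →ₗ[ℂ] H := fun i =>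
    { toFun := fun f => Ψ f (x i)
      map_add' := fun f g => by rw [map_add, add_apply]
      map_smul' := fun c f => by rw [map_smul, smul_apply, RingHom.id_apply] }
  let Φ : ι → Lp ℂ 2 μ →L[ℂ] H := fun i =>
    (L i).extendOfNorm (ContinuousMap.toLp 2 μ ℂ : C(X, ℂ) →L[ℂ] Lp ℂ 2 μ).toLinearMap
  have hΦ : ∀ i f, Φ i (ContinuousMap.toLp 2 μ ℂ f) = Ψ f (x i) := fun i f =>
    LinearMap.extendOfNorm_eq (f := L i)
      (e := (ContinuousMap.toLp 2 μ ℂ : C(X, ℂ) →L[ℂ] Lp ℂ 2 μ).toLinearMap) hd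
      ⟨1, fun g => by rw [one_mul]; exact norm_starAlgHom_apply_le hμ i g⟩ f
  choose h h1 h2 using fun i j => exists_cross_density (hΦ i) (hΦ j)
  refine ⟨μ, hr, hfin, Φ, fun i f hf => ?_, h, h1, h2⟩
  rw [← hΦ, continuousMap_toLp_eq]

end Representation

/-! ### Spectral representation of stationary families over `ℤ²` -/

/-- The character `(z₁, z₂) ↦ z₁^k₁ z₂^k₂` of the torus. -/
def torusMonomial (k : ℤ × ℤ) : C(Torus, ℂ) :=
  ⟨fun z => (z.1 : ℂ) ^ k.1 * (z.2 : ℂ) ^ k.2, by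
    refine Continuous.mul (Continuous.zpow₀ (by fun_prop) _ fun z => Or.inl ?_)
      (Continuous.zpow₀ (by fun_prop) _ fun z => Or.inl ?_)
    · exact ne_zero_of_mem_unit_sphere z.1
    · exact ne_zero_of_mem_unit_sphere z.2⟩

theorem torusMonomial_add (k l : ℤ × ℤ) :
    torusMonomial (k + l) = torusMonomial k * torusMonomial l := by
  ext z
  have h1 : (z.1 : ℂ) ≠ 0 := ne_zero_of_mem_unit_sphere z.1
  have h2 : (z.2 : ℂ) ≠ 0 := ne_zero_of_mem_unit_sphere z.2
  simp only [torusMonomial, ContinuousMap.coe_mk, ContinuousMap.mul_apply, Prod.fst_add,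
    Prod.snd_add, zpow_add₀ h1, zpow_add₀ h2]
  ring

theorem torusMonomial_zero : torusMonomial 0 = 1 := by
  ext z
  simp [torusMonomial]

section Stationary

variable {ι E : Type*} [NormedAddCommGroup E] [InnerProductSpace ℂ E] [CompleteSpace E]

/-- V*V = 1 and VW = 1 force V* = W. -/
theorem linearIsometry_mem_unitary {V W : E →ₗᵢ[ℂ] E} (h : ∀ x, V (W x) = x) :
    V.toContinuousLinearMap ∈ unitary (E →L[ℂ] E) := by
  have h1 : star V.toContinuousLinearMap * V.toContinuousLinearMap = 1 := by
    exact (ContinuousLinearMap.norm_map_iff_adjoint_comp_self _).1 V.norm_map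
  have h2 : V.toContinuousLinearMap * W.toContinuousLinearMap = 1 := by
    ext x
    exact h x
  have h3 : star V.toContinuousLinearMap = W.toContinuousLinearMap := by
    rw [← mul_one (star V.toContinuousLinearMap), ← h2, ← mul_assoc, h1, one_mul]
  exact Unitary.mem_iff.2 ⟨h1, by rw [h3, h2]⟩

/-- Stationarity says that shifting the index preserves the Gram matrix, so each shift extends to an
isometry. Shifts by e and -e are mutually inverse and all shifts commute, which puts the functional
calculus of two commuting unitaries at disposal. -/
theorem exists_torus_shift {y : ι → ℤ × ℤ → E}
    (hd : Dense (Submodule.span ℂ (Set.range fun p : ι × (ℤ × ℤ) => y p.1 p.2) : Set E))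
    (hy : ∀ i j n m e, inner ℂ (y i (n + e)) (y j (m + e)) = inner ℂ (y i n) (y j m)) :
    ∃ Ψ : C(Torus, ℂ) →⋆ₐ[ℂ] (E →L[ℂ] E),
      ∀ k i n, Ψ (torusMonomial k) (y i n) = y i (n + k) := by
  have hV : ∀ e : ℤ × ℤ, ∃ V : E →ₗᵢ[ℂ] E, ∀ p : ι × (ℤ × ℤ), V (y p.1 p.2) = y p.1 (p.2 + e) :=
    fun e => exists_linearIsometry_of_inner_eq hd fun a b => (hy _ _ _ _ _).symm
  choose V hV using hV
  have hV' : ∀ e i n, V e (y i n) = y i (n + e) := fun e i n => hV e (i, n)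
  have hext : ∀ A B : E →L[ℂ] E, (∀ i n, A (y i n) = B (y i n)) → A = B := fun A B h => by
    refine ContinuousLinearMap.ext_on hd ?_
    rintro _ ⟨p, rfl⟩
    exact h _ _
  have hinv : ∀ e x, V e (V (-e) x) = x := fun e x => by
    have := hext ((V e).toContinuousLinearMap * (V (-e)).toContinuousLinearMap) 1 fun i n => by
      change V e (V (-e) (y i n)) = y i n
      rw [hV', hV', neg_add_cancel_right]
    exact DFunLike.congr_fun this x
  have hu : ∀ e, (V e).toContinuousLinearMap ∈ unitary (E →L[ℂ] E) := fun e =>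
    linearIsometry_mem_unitary (hinv e)
  have hcomm : Commute (V (1, 0)).toContinuousLinearMap (V (0, 1)).toContinuousLinearMap :=
    hext _ _ fun i n => by
      change V _ (V _ (y i n)) = V _ (V _ (y i n))
      rw [hV', hV', hV', hV', add_right_comm]
  obtain ⟨Ψ, h1, h2⟩ := exists_torus_starAlgHom (hu (1, 0)) (hu (0, 1)) hcomm
  -- The exponents for which the claim holds form a subgroup, so the two generators suffice.
  let G : AddSubgroup (ℤ × ℤ) :=
    { carrier := {k | ∀ i n, Ψ (torusMonomial k) (y i n) = y i (n + k)}
      zero_mem' := fun i n => by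
        rw [torusMonomial_zero, map_one, add_zero]
        rfl
      add_mem' := fun {k l} hk hl i n => by
        rw [torusMonomial_add, map_mul]
        change Ψ _ (Ψ _ (y i n)) = _
        rw [hl, hk, add_assoc, add_comm l k]
      neg_mem' := fun {k} hk i n => by
        have h : Ψ (torusMonomial (-k)) (Ψ (torusMonomial k) (y i (n + -k))) = y i (n + -k) := by
          change (Ψ (torusMonomial (-k)) * Ψ (torusMonomial k)) _ = _
          rw [← map_mul, ← torusMonomial_add, neg_add_cancel, torusMonomial_zero, map_one]
          rfl
        rwa [hk, neg_add_cancel_right] at h }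
  have hG1 : (1, 0) ∈ G := fun i n => by
    have : torusMonomial (1, 0) = torusFst := by ext z; simp [torusMonomial, torusFst]
    rw [this, h1]
    exact hV' _ i n
  have hG2 : (0, 1) ∈ G := fun i n => by
    have : torusMonomial (0, 1) = torusSnd := by ext z; simp [torusMonomial, torusSnd]
    rw [this, h2]
    exact hV' _ i n
  refine ⟨Ψ, fun k => ?_⟩
  have hk : k = k.1 • (1, 0) + k.2 • (0, 1) := by ext <;> simp
  have : k ∈ G := by
    rw [hk]
    exact G.add_mem (G.zsmul_mem hG1 _) (G.zsmul_mem hG2 _)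
  exact this

/-- A finite family of jointly stationary fields over `ℤ²` is the Fourier transform of a family
of operators on the `L²` space of a finite measure on the torus. -/
theorem exists_stationary_representation [Fintype ι] {y : ι → ℤ × ℤ → E}
    (hy : ∀ i j n m e, inner ℂ (y i (n + e)) (y j (m + e)) = inner ℂ (y i n) (y j m)) :
    ∃ μ : Measure Torus, IsFiniteMeasure μ ∧ ∃ Φ : ι → Lp ℂ 2 μ →L[ℂ] E,
      (∀ i k (hk : MemLp (torusMonomial k) 2 μ), Φ i (hk.toLp _) = y i k) ∧
      ∃ h : ι → ι → Torus → ℂ, (∀ i j, MemLp (h i j) 2 μ) ∧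
        ∀ i j (f g : Torus → ℂ) (hf : MemLp f 2 μ) (hg : MemLp g 2 μ), MemLp g ⊤ μ →
          inner ℂ (Φ j (hg.toLp g)) (Φ i (hf.toLp f)) =
            ∫ z, starRingEnd ℂ (g z) * f z * h i j z ∂μ := by
  -- The shifts are determined only on the closed span of the field, so the representation is built
  -- there and then included in `E`.
  let K : Submodule ℂ E :=
    (Submodule.span ℂ (Set.range fun p : ι × (ℤ × ℤ) => y p.1 p.2)).topologicalClosure
  have hK : IsClosed (K : Set E) := Submodule.isClosed_topologicalClosure _
  have : CompleteSpace K := hK.completeSpace_coe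
  have hmem : ∀ i n, y i n ∈ K := fun i n =>
    Submodule.le_topologicalClosure _ (Submodule.subset_span ⟨(i, n), rfl⟩)
  let x : ι → ℤ × ℤ → K := fun i n => ⟨y i n, hmem i n⟩
  have hd : Dense (Submodule.span ℂ (Set.range fun p : ι × (ℤ × ℤ) => x p.1 p.2) : Set K) := by
    have e : (Submodule.span ℂ (Set.range fun p : ι × (ℤ × ℤ) => x p.1 p.2)).map K.subtype =
        Submodule.span ℂ (Set.range fun p : ι × (ℤ × ℤ) => y p.1 p.2) := by
      rw [Submodule.map_span, ← Set.range_comp]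
      rfl
    rw [Subtype.dense_iff]
    intro v hv
    rw [← Submodule.coe_subtype, ← Submodule.map_coe, e]
    exact hv
  obtain ⟨Ψ, hΨ⟩ := exists_torus_shift hd fun i j n m e => hy i j n m e
  obtain ⟨μ, -, hfin, Φ, hΦ, h, h1, h2⟩ := exists_L2_representation Ψ fun i => x i 0
  refine ⟨μ, hfin, fun i => K.subtypeL.comp (Φ i), fun i k hk => ?_, h, h1,
    fun i j f g hf hg hg' => ?_⟩
  · rw [ContinuousLinearMap.comp_apply, hΦ, hΨ, zero_add]
    rfl
  · rw [← h2 i j f g hf hg hg']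
    rfl

end Stationary

/-! ### Vector measures with values in `L²` and their integrals -/

/-- By Pythagoras the squared distance from a partial sum to v is a - ∑ b i. This yields countable
additivity of L²-valued measures without absolute convergence. -/
theorem hasSum_of_inner_eq {E : Type*} [NormedAddCommGroup E] [InnerProductSpace ℂ E]
    {v : E} {u : ℕ → E} {a : ℝ} {b : ℕ → ℝ} (hv : inner ℂ v v = (a : ℂ))
    (huv : ∀ i, inner ℂ (u i) v = (b i : ℂ)) (huu : ∀ i, inner ℂ (u i) (u i) = (b i : ℂ))
    (hort : ∀ i j, i ≠ j → inner ℂ (u i) (u j) = 0) (hs : HasSum b a) : HasSum u v := by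
  have key : ∀ t : Finset ℕ, ‖∑ i ∈ t, u i - v‖ ^ 2 = a - ∑ i ∈ t, b i := fun t => by
    have hvu : ∀ i, inner ℂ v (u i) = (b i : ℂ) := fun i => by
      rw [← inner_conj_symm, huv, Complex.conj_ofReal]
    have h1 : ∀ i ∈ t, ∑ j ∈ t, inner ℂ (u i) (u j) = (b i : ℂ) := fun i hi => by
      rw [Finset.sum_eq_single i (fun j _ hj => hort i j hj.symm) (fun h => absurd hi h), huu]
    have h2 : inner ℂ (∑ i ∈ t, u i - v) (∑ i ∈ t, u i - v) = ((a - ∑ i ∈ t, b i : ℝ) : ℂ) := by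
      rw [inner_sub_left, inner_sub_right, inner_sub_right, hv, sum_inner, sum_inner, inner_sum]
      simp_rw [inner_sum, huv, hvu]
      rw [Finset.sum_congr rfl h1]
      push_cast
      ring
    rw [inner_self_eq_norm_sq_to_K] at h2
    exact Complex.ofReal_injective (by rw [Complex.ofReal_pow]; exact h2)
  rw [HasSum, SummationFilter.unconditional_filter, tendsto_iff_norm_sub_tendsto_zero]
  have h3 : Tendsto (fun t : Finset ℕ => a - ∑ i ∈ t, b i) atTop (𝓝 (a - a)) :=
    tendsto_const_nhds.sub hs
  rw [sub_self] at h3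
  have h4 := (Real.continuous_sqrt.tendsto 0).comp h3
  rw [Real.sqrt_zero] at h4
  refine h4.congr fun t => ?_
  rw [Function.comp_apply, ← key, Real.sqrt_sq (norm_nonneg _)]

section Pullback

variable {X β : Type*} [MeasurableSpace X] [MeasurableSpace β] {μ : Measure X}

theorem inner_indicator_toLp {A B : Set X} (hA : MeasurableSet A) (hB : MeasurableSet B)
    {w : X → ℂ} (hw : MemLp w 2 μ) :
    inner ℂ ((hw.indicator hA).toLp _) ((hw.indicator hB).toLp _) =
      ((∫ z in A ∩ B, ‖w z‖ ^ 2 ∂μ : ℝ) : ℂ) := by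
  rw [inner_toLp_toLp, ← integral_complex_ofReal, ← integral_indicator (hA.inter hB)]
  refine integral_congr_ae (ae_of_all _ fun z => ?_)
  by_cases h1 : z ∈ A <;> by_cases h2 : z ∈ B <;>
    simp [h1, h2, Complex.conj_mul']

/-- The vector measure `A ↦ 1_{p⁻¹(A)} w` with values in `L²(μ)`. -/
def indicatorMeasure (p : X → β) (hp : Measurable p) {w : X → ℂ} (hw : MemLp w 2 μ) :
    VectorMeasure β (Lp ℂ 2 μ) where
  measureOf' A := by
    classical
    exact if hA : MeasurableSet A then (hw.indicator (hp hA)).toLp _ else 0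
  empty' := by
    rw [dif_pos MeasurableSet.empty]
    simp only [Set.preimage_empty, Set.indicator_empty]
    exact MemLp.toLp_zero _
  not_measurable' A hA := by rw [dif_neg hA]
  m_iUnion' A hA hd := by
    simp only [hA, MeasurableSet.iUnion hA, dite_true]
    have hdisj : ∀ i j, i ≠ j → p ⁻¹' A i ∩ p ⁻¹' A j = ∅ := fun i j hij => by
      rw [← Set.preimage_inter, Set.disjoint_iff_inter_eq_empty.1 (hd hij), Set.preimage_empty]
    have hU := MeasurableSet.iUnion hA
    refine hasSum_of_inner_eq (a := ∫ z in p ⁻¹' ⋃ i, A i, ‖w z‖ ^ 2 ∂μ)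
      (b := fun i => ∫ z in p ⁻¹' A i, ‖w z‖ ^ 2 ∂μ) ?_ (fun i => ?_) (fun i => ?_)
      (fun i j hij => ?_) ?_
    · rw [inner_indicator_toLp (hp hU) (hp hU) hw, Set.inter_self]
    · rw [inner_indicator_toLp (hp (hA i)) (hp hU) hw,
        Set.inter_eq_left.2 (Set.preimage_mono (Set.subset_iUnion A i))]
    · rw [inner_indicator_toLp (hp (hA i)) (hp (hA i)) hw, Set.inter_self]
    · rw [inner_indicator_toLp (hp (hA i)) (hp (hA j)) hw, hdisj i j hij]
      simp
    · rw [Set.preimage_iUnion]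
      exact hasSum_integral_iUnion (fun i => hp (hA i))
        (fun i j hij => Set.disjoint_iff_inter_eq_empty.2 (hdisj i j hij))
        (hw.integrable_norm_pow two_ne_zero).integrableOn

theorem indicatorMeasure_apply {p : X → β} (hp : Measurable p) {w : X → ℂ} (hw : MemLp w 2 μ)
    {A : Set β} (hA : MeasurableSet A) :
    indicatorMeasure p hp hw A = (hw.indicator (hp hA)).toLp _ :=
  dif_pos hA

theorem simpleIntegral_indicatorMeasure {p : X → β} (hp : Measurable p) {w : X → ℂ}
    (hw : MemLp w 2 μ) {K : Set β} (hK : MeasurableSet K) (hpK : ∀ z, p z ∈ K)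
    (s : SimpleFunc β ℂ) :
    (simpleIntegral (indicatorMeasure p hp hw) K s : Lp ℂ 2 μ) =ᵐ[μ] fun z => s (p z) * w z := by
  have h1 : ∀ c : ℂ, ∀ᵐ z ∂μ, (c • indicatorMeasure p hp hw (s ⁻¹' {c} ∩ K)) z =
      if s (p z) = c then c * w z else 0 := fun c => by
    have hm : MeasurableSet (s ⁻¹' {c} ∩ K) := (s.measurableSet_fiber c).inter hK
    rw [indicatorMeasure_apply hp hw hm]
    filter_upwards [Lp.coeFn_smul c ((hw.indicator (hp hm)).toLp _),
      (hw.indicator (hp hm)).coeFn_toLp] with z e1 e2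
    rw [e1, Pi.smul_apply, e2]
    by_cases h : s (p z) = c <;> simp [h, hpK z]
  have h2 : ∀ᵐ z ∂μ, ∀ c ∈ s.range, (c • indicatorMeasure p hp hw (s ⁻¹' {c} ∩ K)) z =
      if s (p z) = c then c * w z else 0 :=
    (Finset.eventually_all _).2 fun c _ => h1 c
  filter_upwards [h2, Lp.coeFn_finsetSum s.range
    fun c => c • indicatorMeasure p hp hw (s ⁻¹' {c} ∩ K)] with z e1 e2
  rw [simpleIntegral, e2, Finset.sum_apply, Finset.sum_congr rfl e1, Finset.sum_ite_eq, if_pos]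
  exact s.mem_range_self _

/-- A simple function s integrates to (s ∘ p) w, so the error is at most sup_K |s - f| times ‖w‖₂.
Uniform approximation is enough and no bound on the variation is needed. -/
theorem hasIntegralOn_indicatorMeasure {p : X → β} (hp : Measurable p) {w : X → ℂ}
    (hw : MemLp w 2 μ) {K : Set β} (hK : MeasurableSet K) (hpK : ∀ z, p z ∈ K) {f : β → ℂ}
    (hf : ∃ s : ℕ → SimpleFunc β ℂ, TendstoUniformlyOn (fun k x => s k x) f atTop K)
    (hfw : MemLp (fun z => f (p z) * w z) 2 μ) :
    HasIntegralOn (indicatorMeasure p hp hw) K f (hfw.toLp _) := by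
  refine ⟨hf, fun s hs => ?_⟩
  rw [tendsto_iff_norm_sub_tendsto_zero]
  have hb : ∀ ε > 0, ∀ᶠ k in atTop,
      ‖simpleIntegral (indicatorMeasure p hp hw) K (s k) - hfw.toLp _‖ ≤ ε * ‖hw.toLp w‖ := by
    intro ε hε
    filter_upwards [Metric.tendstoUniformlyOn_iff.1 hs ε hε] with k hk
    refine Lp.norm_le_mul_norm_of_ae_le_mul ?_
    filter_upwards [simpleIntegral_indicatorMeasure hp hw hK hpK (s k), hfw.coeFn_toLp,
      hw.coeFn_toLp, Lp.coeFn_sub (simpleIntegral (indicatorMeasure p hp hw) K (s k))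
        (hfw.toLp _)] with z e1 e2 e3 e4
    rw [e4, Pi.sub_apply, e1, e2, e3, ← sub_mul, norm_mul]
    have := (hk (p z) (hpK z)).le
    rw [dist_comm, dist_eq_norm] at this
    gcongr
  rw [Metric.tendsto_nhds]
  intro ε hε
  have hC : 0 < ‖hw.toLp w‖ + 1 := by positivity
  filter_upwards [hb (ε / (‖hw.toLp w‖ + 1)) (by positivity)] with k hk
  rw [Real.dist_0_eq_abs, abs_of_nonneg (norm_nonneg _)]
  refine hk.trans_lt ?_
  rw [div_mul_eq_mul_div, div_lt_iff₀ hC]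
  nlinarith

end Pullback

theorem vectorMeasure_sum_apply {β E κ : Type*} [MeasurableSpace β] [NormedAddCommGroup E]
    (t : Finset κ) (M : κ → VectorMeasure β E)
    (A : Set β) : (∑ i ∈ t, M i) A = ∑ i ∈ t, M i A := by
  classical
  induction t using Finset.induction_on with
  | empty => simp
  | insert i t hi ih => rw [Finset.sum_insert hi, Finset.sum_insert hi, add_apply, ih]

section Operations

variable {β E F : Type*} [MeasurableSpace β] [NormedAddCommGroup E] [NormedSpace ℂ E]
  [NormedAddCommGroup F] [NormedSpace ℂ F]

theorem HasIntegralOn.mapRange {M : VectorMeasure β E} {K : Set β} {f : β → ℂ} {I : E}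
    (h : HasIntegralOn M K f I) (T : E →L[ℂ] F) :
    HasIntegralOn (M.mapRange (T : E →+ F) T.continuous) K f (T I) := by
  refine ⟨h.approx, fun s hs => ?_⟩
  refine ((T.continuous.tendsto I).comp (h.tendsto s hs)).congr fun k => ?_
  simp only [Function.comp_apply, simpleIntegral, map_sum, map_smul]
  rfl

theorem hasIntegralOn_sum {κ : Type*} (t : Finset κ) {M : κ → VectorMeasure β E} {K : Set β}
    {f : β → ℂ} {I : κ → E}
    (hf : ∃ s : ℕ → SimpleFunc β ℂ, TendstoUniformlyOn (fun k x => s k x) f atTop K)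
    (h : ∀ i ∈ t, HasIntegralOn (M i) K f (I i)) :
    HasIntegralOn (∑ i ∈ t, M i) K f (∑ i ∈ t, I i) := by
  refine ⟨hf, fun s hs => ?_⟩
  refine (tendsto_finsetSum t fun i hi => (h i hi).tendsto s hs).congr fun k => ?_
  simp only [simpleIntegral, vectorMeasure_sum_apply, Finset.smul_sum]
  rw [Finset.sum_comm]

end Operations

section SumMeasure

variable {X β E κ : Type*} [MeasurableSpace X] [MeasurableSpace β] {μ : Measure X}
  [IsFiniteMeasure μ] [NormedAddCommGroup E] [InnerProductSpace ℂ E]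

/-- A finite sum of operator images of indicator measures, its integrals and its spectral
distribution. -/
theorem exists_sum_indicatorMeasure (t : Finset κ) {p : κ → X → β} (hp : ∀ i, Measurable (p i))
    {w : κ → X → ℂ} (hw : ∀ i, MemLp (w i) ⊤ μ) (T : κ → Lp ℂ 2 μ →L[ℂ] E)
    {h : κ → κ → X → ℂ} (hh : ∀ i j, MemLp (h i j) 2 μ)
    (hT : ∀ i j (f g : X → ℂ) (hf : MemLp f 2 μ) (hg : MemLp g 2 μ), MemLp g ⊤ μ →
      inner ℂ (T j (hg.toLp g)) (T i (hf.toLp f)) =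
        ∫ z, starRingEnd ℂ (g z) * f z * h i j z ∂μ) :
    ∃ φ : VectorMeasure β E,
      (∀ A, MeasurableSet A → (∀ i ∈ t, ∀ z, p i z ∉ A) → φ A = 0) ∧
      (∃ F : ComplexMeasure (β × β),
        (∀ A B, MeasurableSet A → MeasurableSet B → F (A ×ˢ B) = inner ℂ (φ B) (φ A)) ∧
        ∀ C, MeasurableSet C → (∀ i ∈ t, ∀ j ∈ t, ∀ z, (p i z, p j z) ∉ C) → F C = 0) ∧
      ∀ (K : Set β) (f : β → ℂ), MeasurableSet K → (∀ i z, p i z ∈ K) →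
        (∃ s : ℕ → SimpleFunc β ℂ, TendstoUniformlyOn (fun k x => s k x) f atTop K) →
        ∀ hf : ∀ i, MemLp (fun z => f (p i z) * w i z) 2 μ,
          HasIntegralOn φ K f (∑ i ∈ t, T i ((hf i).toLp _)) := by
  have hw2 : ∀ i, MemLp (w i) 2 μ := fun i => (hw i).mono_exponent le_top
  let M : κ → VectorMeasure β E := fun i =>
    (indicatorMeasure (p i) (hp i) (hw2 i)).mapRange (T i : Lp ℂ 2 μ →+ E) (T i).continuous
  have hM : ∀ i A (hA : MeasurableSet A),
      M i A = T i (((hw2 i).indicator (hp i hA)).toLp _) := fun i A hA => by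
    change T i (indicatorMeasure (p i) (hp i) (hw2 i) A) = _
    rw [indicatorMeasure_apply (hp i) (hw2 i) hA]
  let D : κ → κ → X → ℂ := fun i j z => starRingEnd ℂ (w j z) * w i z * h i j z
  have hD : ∀ i j, Integrable (D i j) μ := fun i j =>
    ((hh i j).mul ((hw i).mul (hw j).star : MemLp _ ⊤ μ) : MemLp _ 2 μ).integrable one_le_two
  have hpp : ∀ i j, Measurable fun z => (p i z, p j z) := fun i j => (hp i).prodMk (hp j)
  -- The contribution of the pair (i, j) to the spectral distribution: the cross density pushed to
  -- the curve z ↦ (p i z, p j z). It reproduces the inner products on rectangles and vanishes off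
  -- the image.
  let N : κ → κ → ComplexMeasure (β × β) := fun i j =>
    (μ.withDensityᵥ (D i j)).map fun z => (p i z, p j z)
  have hN : ∀ i j C, MeasurableSet C →
      N i j C = ∫ z in (fun z => (p i z, p j z)) ⁻¹' C, D i j z ∂μ := fun i j C hC => by
    rw [VectorMeasure.map_apply _ (hpp i j) hC, withDensityᵥ_apply (hD i j) (hpp i j hC)]
  refine ⟨∑ i ∈ t, M i, fun A hA h0 => ?_, ⟨∑ i ∈ t, ∑ j ∈ t, N i j, fun A B hA hB => ?_,
    fun C hC h0 => ?_⟩, fun K f hK hpK hs hf => ?_⟩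
  · rw [vectorMeasure_sum_apply]
    refine Finset.sum_eq_zero fun i hi => ?_
    have he : p i ⁻¹' A = ∅ := Set.eq_empty_of_forall_notMem fun z => h0 i hi z
    rw [hM i A hA, ← map_zero (T i)]
    congr 1
    simp only [he, Set.indicator_empty]
    exact MemLp.toLp_zero _
  · simp only [vectorMeasure_sum_apply, sum_inner, inner_sum]
    refine Finset.sum_congr rfl fun i _ => Finset.sum_congr rfl fun j _ => ?_
    rw [hN i j _ (hA.prod hB), hM i A hA, hM j B hB,
      hT i j _ _ ((hw2 i).indicator (hp i hA)) ((hw2 j).indicator (hp j hB))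
        ((hw j).indicator (hp j hB)), ← integral_indicator (hpp i j (hA.prod hB))]
    refine integral_congr_ae (ae_of_all _ fun z => ?_)
    by_cases h1 : p i z ∈ A <;> by_cases h2 : p j z ∈ B <;> simp [h1, h2, D]
  · simp only [vectorMeasure_sum_apply]
    refine Finset.sum_eq_zero fun i hi => Finset.sum_eq_zero fun j hj => ?_
    rw [hN i j C hC, Set.eq_empty_of_forall_notMem (s := (fun z => (p i z, p j z)) ⁻¹' C)
      fun z => h0 i hi j hj z]
    simp
  · exact hasIntegralOn_sum t hs fun i _ =>
      (hasIntegralOn_indicatorMeasure (hp i) (hw2 i) hK (hpK i) hs (hf i)).mapRange (T i)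

end SumMeasure

/-! ### Uniform approximation by simple functions -/

/-- Round the values of f to the nearest of the first k points of a dense sequence; uniformity holds
because finitely many ε-balls cover the compact set f(K). -/
theorem exists_simpleFunc_tendstoUniformlyOn {β : Type*} [TopologicalSpace β] [MeasurableSpace β]
    [OpensMeasurableSpace β] {K : Set β} (hK : IsCompact K) {f : β → ℂ} (hf : Continuous f) :
    ∃ s : ℕ → SimpleFunc β ℂ, TendstoUniformlyOn (fun k x => s k x) f atTop K := by
  let e : ℕ → ℂ := TopologicalSpace.denseSeq ℂ
  refine ⟨fun k => (SimpleFunc.nearestPt e k).comp f hf.measurable,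
    Metric.tendstoUniformlyOn_iff.2 fun ε hε => ?_⟩
  obtain ⟨N, hN⟩ := (hK.image hf).elim_directed_cover (fun n => ⋃ k ≤ n, Metric.ball (e k) ε)
    (fun n => isOpen_biUnion fun k _ => Metric.isOpen_ball)
    (fun z _ => by
      obtain ⟨k, hk⟩ := (TopologicalSpace.denseRange_denseSeq ℂ).exists_dist_lt z hε
      exact Set.mem_iUnion.2 ⟨k, Set.mem_iUnion₂.2 ⟨k, le_rfl, hk⟩⟩)
    (Monotone.directed_le fun m n hmn =>
      Set.biUnion_subset_biUnion_left fun k hk => le_trans hk hmn)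
  filter_upwards [eventually_ge_atTop N] with n hn x hx
  obtain ⟨k, hk, hxk⟩ := Set.mem_iUnion₂.1 (hN (Set.mem_image_of_mem f hx))
  have h1 := SimpleFunc.edist_nearestPt_le e (f x) (le_trans hk hn)
  rw [edist_dist, edist_dist, ENNReal.ofReal_le_ofReal_iff dist_nonneg] at h1
  rw [Metric.mem_ball, dist_comm] at hxk
  rw [dist_comm]
  exact h1.trans_lt hxk

/-! ### Finite Fourier analysis on the box -/

theorem sum_Ico_exp (N : ℕ) (hN : 0 < N) (d : ℤ) :
    ∑ j ∈ Finset.Ico (0 : ℤ) N, Complex.exp (2 * Real.pi * Complex.I * (d * j / N)) =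
      if (N : ℤ) ∣ d then (N : ℂ) else 0 := by
  have hN' : (N : ℂ) ≠ 0 := by exact_mod_cast hN.ne'
  have hpi : (2 * Real.pi * Complex.I : ℂ) ≠ 0 := Complex.two_pi_I_ne_zero
  let ζ : ℂ := Complex.exp (2 * Real.pi * Complex.I * (d / N))
  have hζ : ∀ k : ℕ, Complex.exp (2 * Real.pi * Complex.I * (d * ((k : ℤ) : ℂ) / N)) = ζ ^ k := by
    intro k
    rw [← Complex.exp_nat_mul]
    congr 1
    push_cast
    ring
  have hsum : ∑ j ∈ Finset.Ico (0 : ℤ) N, Complex.exp (2 * Real.pi * Complex.I * (d * j / N)) =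
      ∑ k ∈ Finset.range N, ζ ^ k := by
    symm
    refine Finset.sum_bij (fun k _ => (k : ℤ)) (fun k hk => ?_) (fun _ _ _ _ h => by exact_mod_cast h)
      (fun j hj => ?_) (fun k _ => (hζ k).symm)
    · have := Finset.mem_range.1 hk
      rw [Finset.mem_Ico]
      omega
    · have := Finset.mem_Ico.1 hj
      exact ⟨j.toNat, by rw [Finset.mem_range]; omega, by omega⟩
  have hζN : ζ ^ N = 1 := by
    rw [← hζ, Int.cast_natCast, mul_div_assoc, div_self hN', mul_one, Complex.exp_eq_one_iff]
    exact ⟨d, by ring⟩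
  rw [hsum]
  split_ifs with h
  · obtain ⟨c, rfl⟩ := h
    have : ζ = 1 := by
      refine Complex.exp_eq_one_iff.2 ⟨c, ?_⟩
      push_cast
      field_simp
    simp [this]
  · have h1 : ζ ≠ 1 := fun h1 => by
      obtain ⟨c, hc⟩ := Complex.exp_eq_one_iff.1 h1
      rw [mul_comm (c : ℂ)] at hc
      have hc' := mul_left_cancel₀ hpi hc
      rw [div_eq_iff hN'] at hc'
      refine h ⟨c, ?_⟩
      have : (d : ℂ) = ((c * N : ℤ) : ℂ) := by rw [hc']; push_cast; ring
      rw [mul_comm]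
      exact_mod_cast this
    rw [geom_sum_eq h1, hζN, sub_self, zero_div]

theorem sum_boxChar {U : ℕ × ℕ} (hU₁ : 0 < U.1) (hU₂ : 0 < U.2) (d : ℤ × ℤ) :
    ∑ j ∈ box U, boxChar U d j =
      if (U.1 : ℤ) ∣ d.1 ∧ (U.2 : ℤ) ∣ d.2 then (U.1 : ℂ) * U.2 else 0 := by
  have h : ∀ j : ℤ × ℤ, boxChar U d j =
      Complex.exp (2 * Real.pi * Complex.I * (d.1 * j.1 / U.1)) *
        Complex.exp (2 * Real.pi * Complex.I * (d.2 * j.2 / U.2)) := fun j => by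
    rw [boxChar, mul_add, Complex.exp_add]
  simp_rw [h]
  rw [box, Finset.sum_product]
  dsimp only
  rw [← Finset.sum_mul_sum, sum_Ico_exp _ hU₁, sum_Ico_exp _ hU₂]
  split_ifs <;> simp_all

theorem mem_box {U : ℕ × ℕ} {r : ℤ × ℤ} :
    r ∈ box U ↔ (0 ≤ r.1 ∧ r.1 < U.1) ∧ 0 ≤ r.2 ∧ r.2 < U.2 := by
  rw [box, Finset.mem_product, Finset.mem_Ico, Finset.mem_Ico]

theorem eq_of_dvd_sub_of_mem_Ico {N r s : ℤ} (hr : 0 ≤ r ∧ r < N) (hs : 0 ≤ s ∧ s < N)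
    (h : N ∣ r - s) : r = s := by
  rw [← Int.emod_eq_of_lt hr.1 hr.2, ← Int.emod_eq_of_lt hs.1 hs.2]
  exact ((Int.modEq_iff_dvd).2 h).symm

theorem sum_boxChar_sub {U : ℕ × ℕ} {r s : ℤ × ℤ} (hr : r ∈ box U) (hs : s ∈ box U) :
    ∑ j ∈ box U, boxChar U (r - s) j = if r = s then (U.1 : ℂ) * U.2 else 0 := by
  rw [mem_box] at hr hs
  have hU₁ : 0 < U.1 := by have := hr.1; omega
  have hU₂ : 0 < U.2 := by have := hr.2; omega
  rw [sum_boxChar hU₁ hU₂]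
  refine if_congr ⟨fun h => ?_, fun h => ?_⟩ rfl rfl
  · exact Prod.ext (eq_of_dvd_sub_of_mem_Ico hr.1 hs.1 h.1)
      (eq_of_dvd_sub_of_mem_Ico hr.2 hs.2 h.2)
  · simp [h]

/-- The multiple `(e₁U₁, e₂U₂)` of the period. -/
def periodMul (U : ℕ × ℕ) (e : ℤ × ℤ) : ℤ × ℤ := (e.1 * U.1, e.2 * U.2)

/-- The representative of `n` modulo `U` in the box. -/
def boxMod (U : ℕ × ℕ) (n : ℤ × ℤ) : ℤ × ℤ := (n.1 % U.1, n.2 % U.2)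

/-- The quotient of `n` by `U`. -/
def boxDiv (U : ℕ × ℕ) (n : ℤ × ℤ) : ℤ × ℤ := (n.1 / U.1, n.2 / U.2)

theorem boxMod_mem {U : ℕ × ℕ} (hU₁ : 0 < U.1) (hU₂ : 0 < U.2) (n : ℤ × ℤ) :
    boxMod U n ∈ box U := by
  have h1 : (0 : ℤ) < U.1 := by exact_mod_cast hU₁
  have h2 : (0 : ℤ) < U.2 := by exact_mod_cast hU₂
  exact mem_box.2 ⟨⟨Int.emod_nonneg _ h1.ne', Int.emod_lt_of_pos _ h1⟩,
    Int.emod_nonneg _ h2.ne', Int.emod_lt_of_pos _ h2⟩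

theorem boxMod_add_periodMul (U : ℕ × ℕ) (n : ℤ × ℤ) :
    boxMod U n + periodMul U (boxDiv U n) = n :=
  Prod.ext (Int.emod_add_ediv_mul n.1 U.1) (Int.emod_add_ediv_mul n.2 U.2)

theorem wave_add (m n : ℤ × ℤ) (l : ℝ × ℝ) : wave (m + n) l = wave m l * wave n l := by
  rw [wave, wave, wave, ← Complex.exp_add]
  congr 1
  push_cast [Prod.fst_add, Prod.snd_add]
  ring

theorem norm_wave (n : ℤ × ℤ) (l : ℝ × ℝ) : ‖wave n l‖ = 1 := by
  have : Complex.I * (n.1 * l.1 + n.2 * l.2) = ((n.1 * l.1 + n.2 * l.2 : ℝ) : ℂ) * Complex.I := by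
    push_cast
    ring
  rw [wave, this, Complex.norm_exp_ofReal_mul_I]

theorem continuous_wave (n : ℤ × ℤ) : Continuous (wave n) := by
  unfold wave
  fun_prop

/-! ### Angles and blocks -/

/-- The angle `θ ∈ [0, 2π)` with `e^{-iθ} = z / |z|`. -/
def negArg (z : ℂ) : ℝ := if Complex.arg z ≤ 0 then -Complex.arg z else 2 * Real.pi - Complex.arg z

theorem measurable_negArg : Measurable negArg :=
  Measurable.ite (measurableSet_le Complex.measurable_arg measurable_const)
    Complex.measurable_arg.neg (measurable_const.sub Complex.measurable_arg)

theorem negArg_mem (z : ℂ) : 0 ≤ negArg z ∧ negArg z < 2 * Real.pi := by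
  have h1 := Complex.neg_pi_lt_arg z
  have h2 := Complex.arg_le_pi z
  have h3 := Real.pi_pos
  unfold negArg
  split_ifs <;> constructor <;> linarith

theorem exp_neg_negArg {z : ℂ} (hz : ‖z‖ = 1) : Complex.exp (-(Complex.I * negArg z)) = z := by
  have h : Complex.exp (Complex.arg z * Complex.I) = z := by
    have := Complex.norm_mul_exp_arg_mul_I z
    rwa [hz, Complex.ofReal_one, one_mul] at this
  unfold negArg
  split_ifs
  · rw [← h]
    congr 1
    rw [h]
    push_cast
    ring
  · have e : -(Complex.I * ((2 * Real.pi - Complex.arg z : ℝ) : ℂ)) =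
        Complex.arg z * Complex.I - 2 * Real.pi * Complex.I := by
      push_cast
      ring
    rw [e, Complex.exp_sub, h, Complex.exp_two_pi_mul_I, div_one]

/-- The point of the `j`-th block of sides `2π/U₁`, `2π/U₂` over a point of the torus. -/
def blockPoint (U : ℕ × ℕ) (j : ℤ × ℤ) (z : Torus) : ℝ × ℝ :=
  ((negArg z.1 + 2 * Real.pi * j.1) / U.1, (negArg z.2 + 2 * Real.pi * j.2) / U.2)

theorem measurable_blockPoint (U : ℕ × ℕ) (j : ℤ × ℤ) : Measurable (blockPoint U j) := by
  have h1 : Measurable fun z : Torus => negArg z.1 :=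
    measurable_negArg.comp (measurable_subtype_coe.comp measurable_fst)
  have h2 : Measurable fun z : Torus => negArg z.2 :=
    measurable_negArg.comp (measurable_subtype_coe.comp measurable_snd)
  exact ((h1.add_const _).div_const _).prodMk ((h2.add_const _).div_const _)

theorem block_coord_mem {N : ℕ} {j : ℤ} (hj : 0 ≤ j ∧ j < N) {θ : ℝ}
    (hθ : 0 ≤ θ ∧ θ < 2 * Real.pi) :
    (θ + 2 * Real.pi * j) / N ∈ Set.Ico 0 (2 * Real.pi) := by
  have hN : (0 : ℝ) < N := by
    have : 0 < N := by omega
    exact_mod_cast this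
  have h0 : (0 : ℝ) ≤ j := by exact_mod_cast hj.1
  have h1 : (j : ℝ) + 1 ≤ N := by exact_mod_cast hj.2
  have h3 := Real.pi_pos
  refine ⟨by have := hθ.1; positivity, ?_⟩
  rw [div_lt_iff₀ hN]
  nlinarith [hθ.2]

theorem blockPoint_mem {U : ℕ × ℕ} {j : ℤ × ℤ} (hj : j ∈ box U) (z : Torus) :
    blockPoint U j z ∈ halfOpenSquare := by
  rw [mem_box] at hj
  exact ⟨block_coord_mem hj.1 (negArg_mem _), block_coord_mem hj.2 (negArg_mem _)⟩

theorem halfOpenSquare_subset_square : halfOpenSquare ⊆ square :=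
  Set.prod_mono Set.Ico_subset_Icc_self Set.Ico_subset_Icc_self

/-- Both points are built from the same angles, which cancel in the difference. -/
theorem blockPoint_pair_mem_diagonalSet {U : ℕ × ℕ} {i j : ℤ × ℤ} (hi : i ∈ box U)
    (hj : j ∈ box U) (z : Torus) :
    (blockPoint U i z, blockPoint U j z) ∈ diagonalSet U (i - j) := by
  refine ⟨blockPoint_mem hi z, blockPoint_mem hj z, ?_, ?_⟩
  · simp only [blockPoint, Prod.fst_sub, Int.cast_sub]
    ring
  · simp only [blockPoint, Prod.snd_sub, Int.cast_sub]
    ring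

theorem wave_blockPoint (U : ℕ × ℕ) (d j : ℤ × ℤ) (z : Torus) :
    wave d (blockPoint U j z) = wave d (blockPoint U 0 z) * boxChar U d j := by
  rw [wave, wave, boxChar, ← Complex.exp_add]
  congr 1
  simp only [blockPoint, Prod.fst_zero, Prod.snd_zero, Int.cast_zero]
  push_cast
  ring

/-- Multiplication by N turns the block offset 2πj/N into a multiple of 2π, so frequencies divisible
by the period do not see the block. -/
theorem exp_mul_block_coord {N : ℕ} (hN : 0 < N) (k j : ℤ) {z : ℂ} (hz : ‖z‖ = 1) :
    Complex.exp (Complex.I * (((-(k * N) : ℤ) : ℂ) *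
      (((negArg z + 2 * Real.pi * j) / N : ℝ) : ℂ))) = z ^ k := by
  have hN' : (N : ℂ) ≠ 0 := by exact_mod_cast hN.ne'
  have e : Complex.I * (((-(k * N) : ℤ) : ℂ) * (((negArg z + 2 * Real.pi * j) / N : ℝ) : ℂ)) =
      k * (-(Complex.I * negArg z)) + ((-(k * j) : ℤ) : ℂ) * (2 * Real.pi * Complex.I) := by
    push_cast
    field_simp
    ring
  rw [e, Complex.exp_add, Complex.exp_int_mul_two_pi_mul_I, mul_one, Complex.exp_int_mul,
    exp_neg_negArg hz]

theorem wave_neg_periodMul {U : ℕ × ℕ} (hU₁ : 0 < U.1) (hU₂ : 0 < U.2) (k j : ℤ × ℤ)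
    (z : Torus) : wave (-periodMul U k) (blockPoint U j z) = torusMonomial k z := by
  have h1 := exp_mul_block_coord hU₁ k.1 j.1 (mem_sphere_zero_iff_norm.1 z.1.2)
  have h2 := exp_mul_block_coord hU₂ k.2 j.2 (mem_sphere_zero_iff_norm.1 z.2.2)
  rw [wave, mul_add, Complex.exp_add]
  exact congrArg₂ (· * ·) h1 h2

/-! ### Harmonic representation of periodically correlated fields over `ℤ²` -/

theorem periodMul_add (U : ℕ × ℕ) (k l : ℤ × ℤ) :
    periodMul U (k + l) = periodMul U k + periodMul U l := by
  ext <;> simp [periodMul, add_mul]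

theorem periodMul_zero (U : ℕ × ℕ) : periodMul U 0 = 0 := by
  ext <;> simp [periodMul]

section Harmonic

variable {E : Type*} [NormedAddCommGroup E] [InnerProductSpace ℂ E]

theorem inner_add_periodMul {U : ℕ × ℕ} {y : ℤ × ℤ → E}
    (h1 : ∀ n m, inner ℂ (y (n + periodMul U (1, 0))) (y (m + periodMul U (1, 0))) =
      inner ℂ (y n) (y m))
    (h2 : ∀ n m, inner ℂ (y (n + periodMul U (0, 1))) (y (m + periodMul U (0, 1))) =
      inner ℂ (y n) (y m)) (e n m : ℤ × ℤ) :
    inner ℂ (y (n + periodMul U e)) (y (m + periodMul U e)) = inner ℂ (y n) (y m) := by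
  let G : AddSubgroup (ℤ × ℤ) :=
    { carrier := {e | ∀ n m,
        inner ℂ (y (n + periodMul U e)) (y (m + periodMul U e)) = inner ℂ (y n) (y m)}
      zero_mem' := fun n m => by simp [periodMul_zero]
      add_mem' := fun {k l} hk hl n m => by
        rw [periodMul_add, ← add_assoc, ← add_assoc, hl, hk]
      neg_mem' := fun {k} hk n m => by
        rw [← hk, add_assoc, add_assoc, ← periodMul_add, neg_add_cancel]
        simp [periodMul_zero] }
  have he : e = e.1 • (1, 0) + e.2 • (0, 1) := by ext <;> simp
  have : e ∈ G := by
    rw [he]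
    exact G.add_mem (G.zsmul_mem h1 _) (G.zsmul_mem h2 _)
  exact this n m

variable [CompleteSpace E]

theorem memLp_top_wave {X : Type*} [MeasurableSpace X] {μ : Measure X} {p : X → ℝ × ℝ}
    (hp : Measurable p) (n : ℤ × ℤ) : MemLp (fun z => wave n (p z)) ⊤ μ :=
  memLp_top_of_bound ((continuous_wave n).measurable.comp hp).aestronglyMeasurable 1
    (ae_of_all _ fun _ => (norm_wave n _).le)

theorem isCompact_square : IsCompact square := isCompact_Icc.prod isCompact_Icc

/-- The factor z^k is common to all blocks, and what remains is a full character sum in j at r - s.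
It selects the stationary component to which the index s + kU belongs. -/
theorem smul_sum_wave_blockPoint {U : ℕ × ℕ} (hU₁ : 0 < U.1) (hU₂ : 0 < U.2) {r s : ℤ × ℤ}
    (hr : r ∈ box U) (hs : s ∈ box U) (k : ℤ × ℤ) (z : Torus) :
    1 / ((U.1 : ℂ) * U.2) * ∑ j ∈ box U, wave (-(s + periodMul U k)) (blockPoint U j z) *
      wave r (blockPoint U j z) = if r = s then torusMonomial k z else 0 := by
  have hU : (U.1 : ℂ) * U.2 ≠ 0 := by
    have h1 : (U.1 : ℂ) ≠ 0 := by exact_mod_cast hU₁.ne'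
    have h2 : (U.2 : ℂ) ≠ 0 := by exact_mod_cast hU₂.ne'
    exact mul_ne_zero h1 h2
  have h : ∀ j, wave (-(s + periodMul U k)) (blockPoint U j z) * wave r (blockPoint U j z) =
      torusMonomial k z * wave (r - s) (blockPoint U 0 z) * boxChar U (r - s) j := fun j => by
    rw [← wave_add, show -(s + periodMul U k) + r = -periodMul U k + (r - s) by abel, wave_add,
      wave_neg_periodMul hU₁ hU₂, wave_blockPoint U (r - s)]
    ring
  simp_rw [h]
  rw [← Finset.mul_sum, sum_boxChar_sub hr hs]
  split_ifs with hrs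
  · subst hrs
    have : wave 0 (blockPoint U 0 z) = 1 := by simp [wave]
    rw [sub_self, this, mul_one, mul_comm (torusMonomial k z), ← mul_assoc, one_div,
      inv_mul_cancel₀ hU, one_mul]
  · simp

theorem exists_harmonic_measure {U : ℕ × ℕ} (hU₁ : 0 < U.1) (hU₂ : 0 < U.2) {y : ℤ × ℤ → E}
    (h1 : ∀ n m, inner ℂ (y (n + periodMul U (1, 0))) (y (m + periodMul U (1, 0))) =
      inner ℂ (y n) (y m))
    (h2 : ∀ n m, inner ℂ (y (n + periodMul U (0, 1))) (y (m + periodMul U (0, 1))) =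
      inner ℂ (y n) (y m)) :
    ∃ φ : VectorMeasure (ℝ × ℝ) E,
      (∀ A, MeasurableSet A → Disjoint A halfOpenSquare → φ A = 0) ∧
      (∃ F : ComplexMeasure ((ℝ × ℝ) × (ℝ × ℝ)),
        (∀ A B, MeasurableSet A → MeasurableSet B → F (A ×ˢ B) = inner ℂ (φ B) (φ A)) ∧
        ∀ C, MeasurableSet C →
          (∀ n : ℤ × ℤ, |n.1| < U.1 → |n.2| < U.2 → Disjoint C (diagonalSet U n)) → F C = 0) ∧
      ∀ n, HasIntegralOn φ square (wave (-n)) (y n) := by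
  obtain ⟨μ, hμ, Φ, hΦ, h, hh, hΦh⟩ := exists_stationary_representation (ι := box U)
    (y := fun r k => y (r + periodMul U k)) fun i j n m e => by
      rw [periodMul_add, periodMul_add, ← add_assoc, ← add_assoc]
      exact inner_add_periodMul h1 h2 e _ _
  let c : ℂ := 1 / ((U.1 : ℂ) * U.2)
  -- An index i is a pair: `i.1` is the residue r of a stationary component and `i.2` the block j.
  -- The weight is e^{i r·λ_j} and the operator c Φ_r, whence the factor |c|² in the cross
  -- densities.
  obtain ⟨φ, hφ1, ⟨F, hF1, hF2⟩, hφ2⟩ := exists_sum_indicatorMeasure (μ := μ)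
    (Finset.univ : Finset (box U × box U)) (p := fun i => blockPoint U i.2)
    (fun i => measurable_blockPoint U i.2) (w := fun i z => wave i.1 (blockPoint U i.2 z))
    (fun i => memLp_top_wave (measurable_blockPoint U i.2) i.1) (fun i => c • Φ i.1)
    (h := fun i j z => starRingEnd ℂ c * c * h i.1 j.1 z)
    (fun i j => (hh i.1 j.1).const_mul _) (fun i j f g hf hg hg' => by
      rw [smul_apply, smul_apply, inner_smul_left, inner_smul_right, hΦh _ _ f g hf hg hg',
        ← mul_assoc, ← integral_const_mul]
      refine integral_congr_ae (ae_of_all _ fun z => ?_)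
      dsimp only
      ring)
  refine ⟨φ, fun A hA hd => hφ1 A hA fun i _ z hz => ?_, ⟨F, hF1, fun C hC hd =>
    hF2 C hC fun i _ j _ z hz => ?_⟩, fun n => ?_⟩
  · exact Set.disjoint_left.1 hd hz (blockPoint_mem i.2.2 z)
  · refine Set.disjoint_left.1 (hd (i.2 - j.2) ?_ ?_) hz
      (blockPoint_pair_mem_diagonalSet i.2.2 j.2.2 z)
    · have hi := (mem_box.1 i.2.2).1
      have hj := (mem_box.1 j.2.2).1
      rw [Prod.fst_sub, abs_lt]
      omega
    · have hi := (mem_box.1 i.2.2).2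
      have hj := (mem_box.1 j.2.2).2
      rw [Prod.snd_sub, abs_lt]
      omega
  · have hm : ∀ i : box U × box U, MemLp (fun z => wave (-n) (blockPoint U i.2 z) *
        wave i.1 (blockPoint U i.2 z)) 2 μ := fun i =>
      ((memLp_top_wave (measurable_blockPoint U i.2) i.1).mul
        (memLp_top_wave (measurable_blockPoint U i.2) (-n)) : MemLp _ ⊤ μ).mono_exponent le_top
    have hI := hφ2 square (wave (-n)) isCompact_square.measurableSet
      (fun i z => halfOpenSquare_subset_square (blockPoint_mem i.2.2 z))
      (exists_simpleFunc_tendstoUniformlyOn isCompact_square (continuous_wave _)) hm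
    convert hI
    have hs := boxMod_mem hU₁ hU₂ n
    have hn := boxMod_add_periodMul U n
    let k := boxDiv U n
    have hk := memLp_continuousMap μ 2 (torusMonomial k)
    have inner_sum_eq : ∀ r : box U, c • ∑ j : box U, (hm (r, j)).toLp _ =
        if r = ⟨boxMod U n, hs⟩ then hk.toLp _ else 0 := fun r => by
      apply Lp.ext
      have e1 : ∀ᵐ z ∂μ, ∀ j : box U, (hm (r, j)).toLp _ z =
          wave (-n) (blockPoint U j z) * wave r (blockPoint U j z) :=
        ae_all_iff.2 fun j => (hm (r, j)).coeFn_toLp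
      have e2 : (if r = ⟨boxMod U n, hs⟩ then hk.toLp _ else 0 : Lp ℂ 2 μ) =ᵐ[μ]
          fun z => if r = ⟨boxMod U n, hs⟩ then torusMonomial k z else 0 := by
        split_ifs
        · exact hk.coeFn_toLp
        · exact Lp.coeFn_zero _ _ _
      filter_upwards [e1, e2, Lp.coeFn_smul c (∑ j : box U, (hm (r, j)).toLp _),
        Lp.coeFn_finsetSum Finset.univ fun j : box U => (hm (r, j)).toLp _] with z e1 e2 e3 e4
      rw [e3, e2, Pi.smul_apply, e4, Finset.sum_apply, Finset.sum_congr rfl fun j _ => e1 j,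
        smul_eq_mul]
      have := smul_sum_wave_blockPoint hU₁ hU₂ r.2 hs k z
      rw [hn, ← Finset.sum_coe_sort (box U)] at this
      rw [this]
      exact if_congr ⟨fun h => Subtype.ext h, fun h => congrArg Subtype.val h⟩ rfl rfl
    rw [Fintype.sum_prod_type]
    have hr : ∀ r : box U, ∑ j : box U, (c • Φ (r, j).1) ((hm (r, j)).toLp _) =
        if r = ⟨boxMod U n, hs⟩ then y n else 0 := fun r => by
      have : ∑ j : box U, (c • Φ (r, j).1) ((hm (r, j)).toLp _) =
          Φ r (c • ∑ j : box U, (hm (r, j)).toLp _) := by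
        rw [map_smul, map_sum, Finset.smul_sum]
        rfl
      rw [this, inner_sum_eq]
      split_ifs with h
      · rw [hΦ, h, hn]
      · exact map_zero _
    rw [Finset.sum_congr rfl fun r _ => hr r, Finset.sum_ite_eq', if_pos (Finset.mem_univ _)]

end Harmonic

/-! ### Extension of periodically correlated fields from the quadrant to the lattice -/

/-- A positive semidefinite kernel is the Gram matrix of a family of vectors of a Hilbert space. -/
theorem exists_gram_vectors {κ : Type} {K : κ → κ → ℂ}
    (hherm : ∀ a b, starRingEnd ℂ (K a b) = K b a)
    (hpos : ∀ f : κ →₀ ℂ, 0 ≤ (f.sum fun a x => f.sum fun b y =>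
      starRingEnd ℂ x * y * K a b).re) :
    ∃ (H : Type) (_ : NormedAddCommGroup H) (_ : InnerProductSpace ℂ H) (_ : CompleteSpace H)
      (v : κ → H), (∀ a b, inner ℂ (v a) (v b) = K a b) ∧
      Dense (Submodule.span ℂ (Set.range v) : Set H) := by
  -- The scalar kernel is viewed as a kernel of operators on ℂ; in its reproducing kernel space the
  -- kernel functions applied to 1 have Gram matrix `K`.
  let M : Matrix κ κ (ℂ →L[ℂ] ℂ) := Matrix.of fun a b => K a b • ContinuousLinearMap.id ℂ ℂ
  have hM : M.PosSemidef := by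
    have h := (RKHS.posSemidef_tfae (K := M)).out 0 2
    refine h.2 ⟨?_, fun f => ?_⟩
    · ext a b
      refine ext_inner_left ℂ fun y => ?_
      simp only [Matrix.conjTranspose_apply, ContinuousLinearMap.star_eq_adjoint,
        ContinuousLinearMap.adjoint_inner_right]
      simp [M, ← hherm b a]
    · refine (hpos f).trans_eq ?_
      rw [RCLike.re_to_complex]
      congr 1
      refine Finset.sum_congr rfl fun a _ => Finset.sum_congr rfl fun b _ => ?_
      simp [M, ← hherm b a]
      ring
  have : Fact M.PosSemidef := ⟨hM⟩
  refine ⟨RKHS.OfKernel M, inferInstance, inferInstance, inferInstance,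
    fun a => RKHS.kerFun (RKHS.OfKernel M) a (1 : ℂ), fun a b => ?_, ?_⟩
  · rw [← RKHS.kernel_inner, RKHS.OfKernel.kernel_ofKernel]
    simp [M, hherm]
  · rw [Submodule.dense_iff_topologicalClosure_eq_top, eq_top_iff,
      ← RKHS.kerFun_dense (H := RKHS.OfKernel M)]
    refine Submodule.topologicalClosure_mono (Submodule.span_le.2 ?_)
    rintro _ ⟨a, c, rfl⟩
    have : RKHS.kerFun (RKHS.OfKernel M) a c = c • RKHS.kerFun (RKHS.OfKernel M) a 1 := by
      rw [← map_smul, smul_eq_mul, mul_one]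
    rw [this]
    exact Submodule.smul_mem _ _ (Submodule.subset_span ⟨a, rfl⟩)

/-- Distinct members are at distance √2, so balls of radius 1/2 around them are disjoint. -/
theorem countable_of_orthonormal {κ E : Type*} [NormedAddCommGroup E] [InnerProductSpace ℂ E]
    [TopologicalSpace.SeparableSpace E] {u : κ → E} (hu : Orthonormal ℂ u) : Countable κ := by
  refine Pairwise.countable_of_isOpen_disjoint (s := fun i => Metric.ball (u i) (1 / 2))
    (fun i j hij => Metric.ball_disjoint_ball ?_) (fun i => Metric.isOpen_ball)
    fun i => Metric.nonempty_ball.2 (by norm_num)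
  have h1 : ‖u i - u j‖ ^ 2 = 2 := by
    have h := norm_sub_sq (𝕜 := ℂ) (u i) (u j)
    rw [hu.2 hij, hu.1, hu.1] at h
    rw [h]
    norm_num
  rw [dist_eq_norm]
  nlinarith [norm_nonneg (u i - u j)]

theorem inner_linearIsometry_eq_zero {κ E F : Type*} [NormedAddCommGroup E]
    [InnerProductSpace ℂ E] [NormedAddCommGroup F] [InnerProductSpace ℂ F] {u : κ → E}
    (hu : Dense (Submodule.span ℂ (Set.range u) : Set E)) (V : E →ₗᵢ[ℂ] F) {z : F}
    (h : ∀ a, inner ℂ z (V (u a)) = 0) (x : E) : inner ℂ z (V x) = 0 := by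
  have : (innerSL ℂ z).comp V.toContinuousLinearMap = 0 := by
    refine ContinuousLinearMap.ext_on hu ?_
    rintro _ ⟨a, rfl⟩
    exact h a
  exact DFunLike.congr_fun this x

theorem dense_span_codRestrict {κ E : Type*} [NormedAddCommGroup E] [InnerProductSpace ℂ E]
    (v : κ → E) (hv : ∀ a, v a ∈ (Submodule.span ℂ (Set.range v)).topologicalClosure) :
    Dense (Submodule.span ℂ (Set.range fun a =>
      (⟨v a, hv a⟩ : (Submodule.span ℂ (Set.range v)).topologicalClosure)) :
      Set (Submodule.span ℂ (Set.range v)).topologicalClosure) := by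
  have e : (Submodule.span ℂ (Set.range fun a =>
      (⟨v a, hv a⟩ : (Submodule.span ℂ (Set.range v)).topologicalClosure))).map
        (Submodule.span ℂ (Set.range v)).topologicalClosure.subtype =
      Submodule.span ℂ (Set.range v) := by
    rw [Submodule.map_span, ← Set.range_comp]
    rfl
  rw [Subtype.dense_iff]
  intro x hx
  rw [← Submodule.coe_subtype, ← Submodule.map_coe, e]
  exact hx

/-- Vectors of a Hilbert space `F` with the Gram matrix of a part of a countable family `v` can be
completed to a family with the Gram matrix of `v` if there is an orthonormal sequence that is
orthogonal to them. -/
theorem exists_gram_extension {κ H F : Type*} [Countable κ] [NormedAddCommGroup H]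
    [InnerProductSpace ℂ H] [CompleteSpace H] [NormedAddCommGroup F] [InnerProductSpace ℂ F]
    [CompleteSpace F] {v : κ → H} (hv : Dense (Submodule.span ℂ (Set.range v) : Set H))
    {s : Set κ} {u : κ → F} (hu : ∀ a ∈ s, ∀ b ∈ s, inner ℂ (u a) (u b) = inner ℂ (v a) (v b))
    {g : ℕ → F} (hg : Orthonormal ℂ g) (hgu : ∀ k, ∀ a ∈ s, inner ℂ (g k) (u a) = 0) :
    ∃ y : κ → F, (∀ a ∈ s, y a = u a) ∧ ∀ a b, inner ℂ (y a) (y b) = inner ℂ (v a) (v b) := by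
  have hsep : TopologicalSpace.SeparableSpace H := by
    rw [← TopologicalSpace.isSeparable_univ_iff, ← hv.closure_eq]
    exact (Set.countable_range v).isSeparable.span.closure
  have : SecondCountableTopology H := UniformSpace.secondCountable_of_separable H
  let S : Submodule ℂ H := (Submodule.span ℂ (Set.range fun a : s => v a)).topologicalClosure
  have : CompleteSpace S := (Submodule.isClosed_topologicalClosure _).completeSpace_coe
  have hmem : ∀ a : s, v a ∈ S := fun a =>
    Submodule.le_topologicalClosure _ (Submodule.subset_span ⟨a, rfl⟩)
  have hd := dense_span_codRestrict (fun a : s => v a) hmem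
  obtain ⟨J, hJ⟩ := exists_linearIsometry_of_inner_eq (v := fun a : s => u a) hd
    fun a b => (hu a a.2 b b.2).symm
  -- `J` carries the prescribed part `S` to the given vectors. By separability its complement has a
  -- countable orthonormal basis, which `J'` sends into the sequence `g`.
  obtain ⟨w, b, -⟩ := exists_hilbertBasis ℂ Sᗮ
  have hw : Countable w := countable_of_orthonormal b.orthonormal
  obtain ⟨ι, hι⟩ := exists_injective_nat w
  have hbd : Dense (Submodule.span ℂ (Set.range b) : Set Sᗮ) :=
    Submodule.dense_iff_topologicalClosure_eq_top.2 b.dense_span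
  have hgι : Orthonormal ℂ (g ∘ ι) := hg.comp ι hι
  obtain ⟨J', hJ'⟩ := exists_linearIsometry_of_inner_eq (v := g ∘ ι) hbd fun i j => by
    classical
    rw [orthonormal_iff_ite.1 b.orthonormal, orthonormal_iff_ite.1 hgι]
  have hort : ∀ x x', inner ℂ (J' x') (J x) = 0 := fun x x' => by
    rw [← inner_conj_symm, inner_linearIsometry_eq_zero hbd J' (fun i => ?_) x', map_zero]
    rw [hJ', ← inner_conj_symm, inner_linearIsometry_eq_zero hd J (fun a => ?_) x, map_zero]
    rw [hJ]
    exact hgu _ _ a.2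
  have hort' : ∀ x x', inner ℂ (J x) (J' x') = 0 := fun x x' => by
    rw [← inner_conj_symm, hort, map_zero]
  -- The ranges of `J` and `J'` are orthogonal, so this sum is isometric in v a; for a in s the
  -- second term is zero.
  refine ⟨fun a => J (S.orthogonalProjectionOnto (v a)) + J' (Sᗮ.orthogonalProjectionOnto (v a)),
    fun a ha => ?_, fun a b => ?_⟩
  · have h1 : S.orthogonalProjectionOnto (v a) = ⟨v a, hmem ⟨a, ha⟩⟩ :=
      S.orthogonalProjectionOnto_mem_subspace_eq_self ⟨v a, hmem ⟨a, ha⟩⟩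
    have h2 : Sᗮ.orthogonalProjectionOnto (v a) = 0 := by
      rw [Submodule.orthogonalProjectionOnto_eq_zero_iff]
      exact Submodule.le_orthogonal_orthogonal S (hmem ⟨a, ha⟩)
    dsimp only
    rw [h1, h2, map_zero, add_zero]
    exact hJ ⟨a, ha⟩
  · rw [inner_add_left, inner_add_right, inner_add_right, hort, hort', J.inner_map_map,
      J'.inner_map_map, add_zero, zero_add, Submodule.inner_orthogonalProjectionOnto_eq_of_mem_left,
      Submodule.inner_orthogonalProjectionOnto_eq_of_mem_left, ← inner_add_left]
    congr 1
    exact S.starProjection_add_starProjection_orthogonal (v a)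

theorem kernel_add_periodMul_of_nonneg {U : ℕ × ℕ} {C : ℤ × ℤ → ℤ × ℤ → ℂ}
    (h1 : ∀ n m, 0 ≤ n → 0 ≤ m →
      C (n + periodMul U (1, 0)) (m + periodMul U (1, 0)) = C n m)
    (h2 : ∀ n m, 0 ≤ n → 0 ≤ m →
      C (n + periodMul U (0, 1)) (m + periodMul U (0, 1)) = C n m)
    {n m : ℤ × ℤ} (hn : 0 ≤ n) (hm : 0 ≤ m) (a b : ℕ) :
    C (n + periodMul U (a, b)) (m + periodMul U (a, b)) = C n m := by
  have hpos : ∀ a b : ℕ, (0 : ℤ × ℤ) ≤ periodMul U (a, b) := fun a b =>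
    ⟨by simp only [periodMul, Prod.fst_zero]; positivity,
      by simp only [periodMul, Prod.snd_zero]; positivity⟩
  induction a with
  | zero =>
    induction b with
    | zero =>
      have : periodMul U ((0 : ℕ), (0 : ℕ)) = 0 := periodMul_zero U
      rw [this, add_zero, add_zero]
    | succ b ih =>
      have : periodMul U ((0 : ℕ), (b + 1 : ℕ)) = periodMul U ((0 : ℕ), b) + periodMul U (0, 1) := by
        rw [← periodMul_add]
        simp
      rw [this, ← add_assoc, ← add_assoc,
        h2 _ _ (add_nonneg hn (hpos _ _)) (add_nonneg hm (hpos _ _)), ih]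
  | succ a ih =>
    have : periodMul U ((a + 1 : ℕ), b) = periodMul U (a, b) + periodMul U (1, 0) := by
      rw [← periodMul_add]
      simp
    rw [this, ← add_assoc, ← add_assoc,
      h1 _ _ (add_nonneg hn (hpos _ _)) (add_nonneg hm (hpos _ _)), ih]

section Lattice

variable {F : Type*} [NormedAddCommGroup F] [InnerProductSpace ℂ F]

theorem nonneg_add_periodMul {U : ℕ × ℕ} (hU₁ : 0 < U.1) (hU₂ : 0 < U.2) {n : ℤ × ℤ} {N : ℕ}
    (hN : n.1.natAbs + n.2.natAbs ≤ N) : 0 ≤ n + periodMul U (N, N) := by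
  have h1 : (N : ℤ) ≤ N * U.1 := by nlinarith
  have h2 : (N : ℤ) ≤ N * U.2 := by nlinarith
  refine ⟨?_, ?_⟩
  · change 0 ≤ n.1 + N * U.1
    omega
  · change 0 ≤ n.2 + N * U.2
    omega

/-- A periodically correlated field on the quadrant extends to the lattice, if there is an
orthonormal sequence that is orthogonal to it. -/
theorem exists_lattice_extension [CompleteSpace F] {U : ℕ × ℕ} (hU₁ : 0 < U.1) (hU₂ : 0 < U.2)
    {Y : ℤ × ℤ → F}
    (h1 : ∀ n m, 0 ≤ n → 0 ≤ m →
      inner ℂ (Y (n + periodMul U (1, 0))) (Y (m + periodMul U (1, 0))) = inner ℂ (Y n) (Y m))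
    (h2 : ∀ n m, 0 ≤ n → 0 ≤ m →
      inner ℂ (Y (n + periodMul U (0, 1))) (Y (m + periodMul U (0, 1))) = inner ℂ (Y n) (Y m))
    {g : ℕ → F} (hg : Orthonormal ℂ g) (hgY : ∀ k n, 0 ≤ n → inner ℂ (g k) (Y n) = 0) :
    ∃ y : ℤ × ℤ → F, (∀ n, 0 ≤ n → y n = Y n) ∧
      (∀ n m, inner ℂ (y (n + periodMul U (1, 0))) (y (m + periodMul U (1, 0))) =
        inner ℂ (y n) (y m)) ∧
      ∀ n m, inner ℂ (y (n + periodMul U (0, 1))) (y (m + periodMul U (0, 1))) =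
        inner ℂ (y n) (y m) := by
  -- Since both periods are at least 1, shifting n by any N ≥ `B n` periods in each direction lands
  -- in the quadrant.
  let B : ℤ × ℤ → ℕ := fun n => n.1.natAbs + n.2.natAbs
  let G : ℕ → ℤ × ℤ → ℤ × ℤ → ℂ := fun N n m =>
    inner ℂ (Y (n + periodMul U (N, N))) (Y (m + periodMul U (N, N)))
  have hstep := @kernel_add_periodMul_of_nonneg U (fun n m => inner ℂ (Y n) (Y m)) h1 h2
  have hnn : ∀ {n N}, B n ≤ N → 0 ≤ n + periodMul U (N, N) := fun h =>
    nonneg_add_periodMul hU₁ hU₂ h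
  have hGadd : ∀ N k n m, B n ≤ N → B m ≤ N → G (N + k) n m = G N n m := fun N k n m hn hm => by
    have : periodMul U ((N + k : ℕ), (N + k : ℕ)) = periodMul U (N, N) + periodMul U (k, k) := by
      rw [← periodMul_add]
      simp
    simp only [G, this, ← add_assoc]
    exact hstep (hnn hn) (hnn hm) k k
  -- The extended moment kernel; by `hGadd` any sufficiently large number of periods gives the same
  -- value.
  let K : ℤ × ℤ → ℤ × ℤ → ℂ := fun n m => G (B n + B m) n m
  have hGK : ∀ N n m, B n ≤ N → B m ≤ N → G N n m = K n m := fun N n m hn hm => by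
    rw [← hGadd N (B n + B m) n m hn hm, add_comm N,
      hGadd _ N n m (Nat.le_add_right _ _) (Nat.le_add_left _ _)]
  have hK0 : ∀ n m, 0 ≤ n → 0 ≤ m → K n m = inner ℂ (Y n) (Y m) := fun n m hn hm =>
    hstep hn hm _ _
  have hK1 : ∀ n m, K (n + periodMul U (1, 0)) (m + periodMul U (1, 0)) = K n m := fun n m => by
    rw [← hGK (B n + B m + B (n + periodMul U (1, 0)) + B (m + periodMul U (1, 0))) n m
        (by omega) (by omega),
      ← hGK (B n + B m + B (n + periodMul U (1, 0)) + B (m + periodMul U (1, 0))) _ _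
        (by omega) (by omega)]
    simp only [G]
    rw [add_right_comm n, add_right_comm m]
    exact h1 _ _ (hnn (by omega)) (hnn (by omega))
  have hK2 : ∀ n m, K (n + periodMul U (0, 1)) (m + periodMul U (0, 1)) = K n m := fun n m => by
    rw [← hGK (B n + B m + B (n + periodMul U (0, 1)) + B (m + periodMul U (0, 1))) n m
        (by omega) (by omega),
      ← hGK (B n + B m + B (n + periodMul U (0, 1)) + B (m + periodMul U (0, 1))) _ _
        (by omega) (by omega)]
    simp only [G]
    rw [add_right_comm n, add_right_comm m]
    exact h2 _ _ (hnn (by omega)) (hnn (by omega))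
  obtain ⟨H, _, _, _, v, hv, hd⟩ := exists_gram_vectors (K := K) (fun a b => by
      simp only [K, G]
      rw [inner_conj_symm, add_comm (B a)]) (fun f => by
      -- One `N` moves the whole finite support into the quadrant, so the quadratic form is the
      -- squared norm of an actual combination of values of `Y`.
      obtain ⟨N, hN⟩ : ∃ N, N = f.support.sup B := ⟨_, rfl⟩
      have hB : ∀ n ∈ f.support, B n ≤ N := fun n hn => hN ▸ Finset.le_sup hn
      have : (f.sum fun n x => f.sum fun m y => starRingEnd ℂ x * y * K n m) =
          inner ℂ (f.sum fun n x => x • Y (n + periodMul U (N, N)))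
            (f.sum fun n x => x • Y (n + periodMul U (N, N))) := by
        simp only [Finsupp.sum, sum_inner, inner_sum, inner_smul_left, inner_smul_right,
          Finset.mul_sum]
        rw [Finset.sum_comm]
        refine Finset.sum_congr rfl fun m hm => Finset.sum_congr rfl fun n hn => ?_
        rw [← hGK _ n m (hB n hn) (hB m hm)]
        ring
      rw [this]
      exact inner_self_nonneg (𝕜 := ℂ))
  obtain ⟨y, hy, hyy⟩ := exists_gram_extension hd (s := {n | 0 ≤ n}) (u := Y)
    (fun n hn m hm => by rw [hv, hK0 n m hn hm]) hg hgY
  refine ⟨y, hy, fun n m => ?_, fun n m => ?_⟩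
  · rw [hyy, hyy, hv, hv, hK1]
  · rw [hyy, hyy, hv, hv, hK2]

end Lattice

/-! ### An orthonormal sequence from an independent uniform variable -/

theorem integral_unitInterval_exp {m : ℤ} (hm : m ≠ 0) :
    ∫ t : unitInterval, Complex.exp (2 * Real.pi * Complex.I * m * ((t : ℝ) : ℂ)) = 0 := by
  have hc : (2 * Real.pi * Complex.I * m : ℂ) ≠ 0 :=
    mul_ne_zero Complex.two_pi_I_ne_zero (by exact_mod_cast hm)
  rw [unitInterval.measurePreserving_coe.integral_comp unitInterval.measurableEmbedding_coe
    fun t : ℝ => Complex.exp (2 * Real.pi * Complex.I * m * (t : ℂ)),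
    integral_Icc_eq_integral_Ioc, ← intervalIntegral.integral_of_le zero_le_one,
    integral_exp_mul_complex hc]
  have : (2 * Real.pi * Complex.I * m : ℂ) = m * (2 * Real.pi * Complex.I) := by ring
  rw [this]
  simp [Complex.exp_int_mul_two_pi_mul_I]

/-- The function `(ω, t) ↦ e^{2πi(k+1)t}`. -/
def uniformWave {Ω : Type*} (k : ℕ) (x : Ω × unitInterval) : ℂ :=
  -- The frequency k + 1 excludes the constant function, which would not be orthogonal to functions
  -- of ω.
  Complex.exp (2 * Real.pi * Complex.I * ((k : ℤ) + 1 : ℤ) * ((x.2 : ℝ) : ℂ))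

theorem norm_uniformWave {Ω : Type*} (k : ℕ) (x : Ω × unitInterval) : ‖uniformWave k x‖ = 1 := by
  have : (2 * Real.pi * Complex.I * ((k : ℤ) + 1 : ℤ) * ((x.2 : ℝ) : ℂ) : ℂ) =
      ((2 * Real.pi * ((k : ℤ) + 1 : ℤ) * x.2 : ℝ) : ℂ) * Complex.I := by
    push_cast
    ring
  rw [uniformWave, this, Complex.norm_exp_ofReal_mul_I]

variable {Ω : Type*} [MeasurableSpace Ω]

theorem measurable_uniformWave (k : ℕ) : Measurable (uniformWave k : Ω × unitInterval → ℂ) := by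
  unfold uniformWave
  fun_prop

theorem memLp_uniformWave (P : Measure Ω) [IsProbabilityMeasure P] (k : ℕ) :
    MemLp (uniformWave k) 2 (P.prod (volume : Measure unitInterval)) :=
  (memLp_top_of_bound (measurable_uniformWave k).aestronglyMeasurable 1
    (ae_of_all _ fun x => (norm_uniformWave k x).le)).mono_exponent le_top

theorem orthonormal_uniformWave (P : Measure Ω) [IsProbabilityMeasure P] :
    Orthonormal ℂ fun k => (memLp_uniformWave P k).toLp _ := by
  rw [orthonormal_iff_ite]
  intro j k
  rw [inner_toLp_toLp]
  split_ifs with h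
  · subst h
    simp [Complex.conj_mul', norm_uniformWave]
  · have e : ∀ x : Ω × unitInterval, starRingEnd ℂ (uniformWave j x) * uniformWave k x =
        1 * Complex.exp (2 * Real.pi * Complex.I * ((k - j : ℤ) : ℂ) * ((x.2 : ℝ) : ℂ)) := fun x => by
      rw [uniformWave, uniformWave, ← Complex.exp_conj, ← Complex.exp_add, one_mul]
      congr 1
      simp only [map_mul, Complex.conj_I, Complex.conj_ofReal, map_ofNat, map_intCast]
      push_cast
      ring
    simp_rw [e]
    rw [integral_prod_mul (fun _ : Ω => (1 : ℂ)) fun t : unitInterval =>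
      Complex.exp (2 * Real.pi * Complex.I * ((k - j : ℤ) : ℂ) * ((t : ℝ) : ℂ)),
      integral_unitInterval_exp (sub_ne_zero.2 (by exact_mod_cast Ne.symm h)), mul_zero]

/-- The integral over the product factors, and a nonconstant exponential has mean zero on [0,1]. -/
theorem inner_uniformWave_comp_fst (P : Measure Ω) [IsProbabilityMeasure P] (k : ℕ) {f : Ω → ℂ}
    (hf : MemLp (fun x : Ω × unitInterval => f x.1) 2 (P.prod volume)) :
    inner ℂ ((memLp_uniformWave P k).toLp _) (hf.toLp _) = 0 := by
  rw [← inner_conj_symm, inner_toLp_toLp]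
  have e : ∀ x : Ω × unitInterval, starRingEnd ℂ (f x.1) * uniformWave k x =
      starRingEnd ℂ (f x.1) *
        Complex.exp (2 * Real.pi * Complex.I * ((k : ℤ) + 1 : ℤ) * ((x.2 : ℝ) : ℂ)) :=
    fun x => rfl
  simp_rw [e]
  rw [integral_prod_mul (fun ω : Ω => starRingEnd ℂ (f ω)) fun t : unitInterval =>
    Complex.exp (2 * Real.pi * Complex.I * ((k : ℤ) + 1 : ℤ) * ((t : ℝ) : ℂ)),
    integral_unitInterval_exp (by omega), mul_zero, map_zero]

/-! ### Second moments of the inverse quasi-Lamperti transform -/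

theorem scaleFactor_add {α : ℝ × ℝ} (hα₁ : 1 < α.1) (hα₂ : 1 < α.2) (H : ℝ × ℝ) (k l : ℤ × ℤ) :
    scaleFactor α H (k + l) = scaleFactor α H k * scaleFactor α H l := by
  simp only [scaleFactor, Prod.fst_add, Prod.snd_add, Int.cast_add, add_mul]
  rw [Real.rpow_add (by linarith), Real.rpow_add (by linarith)]
  ring

theorem scaleFactor_zero (α H : ℝ × ℝ) : scaleFactor α H 0 = 1 := by
  simp [scaleFactor]

theorem scaleFactor_mul_neg {α : ℝ × ℝ} (hα₁ : 1 < α.1) (hα₂ : 1 < α.2) (H : ℝ × ℝ)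
    (k : ℤ × ℤ) : scaleFactor α H k * scaleFactor α H (-k) = 1 := by
  rw [← scaleFactor_add hα₁ hα₂, add_neg_cancel, scaleFactor_zero]

theorem hadamard_samplePoint {α : ℝ × ℝ} (hα₁ : 1 < α.1) (hα₂ : 1 < α.2) (q : ℕ × ℕ)
    (n : ℤ × ℤ) : hadamard (α.1 ^ q.1, α.2 ^ q.2) (samplePoint α n) =
      samplePoint α (n + ((q.1 : ℤ), (q.2 : ℤ))) := by
  have h1 : α.1 ≠ 0 := by linarith
  have h2 : α.2 ≠ 0 := by linarith
  simp only [hadamard, samplePoint, Prod.fst_add, Prod.snd_add, zpow_add₀ h1, zpow_add₀ h2,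
    zpow_natCast, mul_comm]

section Moments

variable {Ω : Type*} [MeasurableSpace Ω] {P : Measure Ω} {α H : ℝ × ℝ} {T : Set (ℝ × ℝ)}
  {X : ℝ × ℝ → Ω → ℂ}

theorem scaleFactor_natCast {α : ℝ × ℝ} (hα₁ : 1 < α.1) (hα₂ : 1 < α.2) (H : ℝ × ℝ)
    (q : ℕ × ℕ) : (α.1 ^ q.1) ^ H.1 * (α.2 ^ q.2) ^ H.2 =
      scaleFactor α H ((q.1 : ℤ), (q.2 : ℤ)) := by
  rw [← Real.rpow_natCast_mul (by linarith), ← Real.rpow_natCast_mul (by linarith)]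
  simp [scaleFactor]

theorem scaleFactor_natCast_two_mul {α : ℝ × ℝ} (hα₁ : 1 < α.1) (hα₂ : 1 < α.2) (H : ℝ × ℝ)
    (q : ℕ × ℕ) : (α.1 ^ q.1) ^ (2 * H.1) * (α.2 ^ q.2) ^ (2 * H.2) =
      scaleFactor α H ((q.1 : ℤ), (q.2 : ℤ)) * scaleFactor α H ((q.1 : ℤ), (q.2 : ℤ)) := by
  have h1 : 0 < α.1 ^ q.1 := by positivity
  have h2 : 0 < α.2 ^ q.2 := by positivity
  rw [← scaleFactor_natCast hα₁ hα₂, two_mul, two_mul, Real.rpow_add h1, Real.rpow_add h2]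
  ring

theorem integral_lampertiInv_add (hα₁ : 1 < α.1) (hα₂ : 1 < α.2) {q : ℕ × ℕ}
    (hX : ScalesBy P T H (α.1 ^ q.1, α.2 ^ q.2) X) {n : ℤ × ℤ} (hn : samplePoint α n ∈ T)
    (hn' : samplePoint α (n + ((q.1 : ℤ), (q.2 : ℤ))) ∈ T) :
    ∫ ω, lampertiInv α H X (n + ((q.1 : ℤ), (q.2 : ℤ))) ω ∂P = ∫ ω, lampertiInv α H X n ω ∂P := by
  have h := hX.mean _ hn (by rwa [hadamard_samplePoint hα₁ hα₂])
  rw [hadamard_samplePoint hα₁ hα₂] at h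
  dsimp only at h
  rw [scaleFactor_natCast hα₁ hα₂] at h
  have hs : ((scaleFactor α H ((q.1 : ℤ), (q.2 : ℤ)) : ℝ) : ℂ) *
      ((scaleFactor α H (-((q.1 : ℤ), (q.2 : ℤ))) : ℝ) : ℂ) = 1 := by
    exact_mod_cast scaleFactor_mul_neg hα₁ hα₂ H _
  simp only [lampertiInv]
  rw [integral_const_mul, integral_const_mul, h, neg_add, scaleFactor_add hα₁ hα₂,
    Complex.ofReal_mul]
  linear_combination ((scaleFactor α H (-n) : ℝ) : ℂ) * (∫ ω, X (samplePoint α n) ω ∂P) * hs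

theorem integral_lampertiInv_mul_conj (n m : ℤ × ℤ) :
    ∫ ω, lampertiInv α H X n ω * starRingEnd ℂ (lampertiInv α H X m ω) ∂P =
      ((scaleFactor α H (-n) : ℝ) : ℂ) * ((scaleFactor α H (-m) : ℝ) : ℂ) *
        ∫ ω, X (samplePoint α n) ω * starRingEnd ℂ (X (samplePoint α m) ω) ∂P := by
  rw [← integral_const_mul]
  refine integral_congr_ae (ae_of_all _ fun ω => ?_)
  simp only [lampertiInv, map_mul, Complex.conj_ofReal]
  ring

/-- The two normalizing factors α^{-qH} cancel the factor α^{2qH} of the scaling law. -/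
theorem moment_lampertiInv_add (hα₁ : 1 < α.1) (hα₂ : 1 < α.2) {q : ℕ × ℕ}
    (hX : ScalesBy P T H (α.1 ^ q.1, α.2 ^ q.2) X) {n m : ℤ × ℤ} (hn : samplePoint α n ∈ T)
    (hm : samplePoint α m ∈ T) (hn' : samplePoint α (n + ((q.1 : ℤ), (q.2 : ℤ))) ∈ T)
    (hm' : samplePoint α (m + ((q.1 : ℤ), (q.2 : ℤ))) ∈ T) :
    ∫ ω, lampertiInv α H X (n + ((q.1 : ℤ), (q.2 : ℤ))) ω *
        starRingEnd ℂ (lampertiInv α H X (m + ((q.1 : ℤ), (q.2 : ℤ))) ω) ∂P =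
      ∫ ω, lampertiInv α H X n ω * starRingEnd ℂ (lampertiInv α H X m ω) ∂P := by
  have h := hX.moment _ hn _ hm (by rwa [hadamard_samplePoint hα₁ hα₂])
    (by rwa [hadamard_samplePoint hα₁ hα₂])
  rw [hadamard_samplePoint hα₁ hα₂, hadamard_samplePoint hα₁ hα₂] at h
  dsimp only at h
  rw [scaleFactor_natCast_two_mul hα₁ hα₂] at h
  have hs : ((scaleFactor α H ((q.1 : ℤ), (q.2 : ℤ)) : ℝ) : ℂ) *
      ((scaleFactor α H (-((q.1 : ℤ), (q.2 : ℤ))) : ℝ) : ℂ) = 1 := by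
    exact_mod_cast scaleFactor_mul_neg hα₁ hα₂ H _
  rw [integral_lampertiInv_mul_conj, integral_lampertiInv_mul_conj, h, neg_add, neg_add,
    scaleFactor_add hα₁ hα₂, scaleFactor_add hα₁ hα₂]
  push_cast
  set s := ((scaleFactor α H ((q.1 : ℤ), (q.2 : ℤ)) : ℝ) : ℂ)
  set t := ((scaleFactor α H (-((q.1 : ℤ), (q.2 : ℤ))) : ℝ) : ℂ)
  -- What is needed is s²t² = 1, and s²t² - 1 = (st + 1)(st - 1).
  linear_combination ((scaleFactor α H (-n) : ℝ) : ℂ) * ((scaleFactor α H (-m) : ℝ) : ℂ) *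
    (∫ ω, X (samplePoint α n) ω * starRingEnd ℂ (X (samplePoint α m) ω) ∂P) * (s * t + 1) * hs

theorem ccov_eq_sub [IsProbabilityMeasure P] {f g : Ω → ℂ} (hf : MemLp f 2 P) (hg : MemLp g 2 P) :
    ccov P f g = ∫ ω, f ω * starRingEnd ℂ (g ω) ∂P -
      (∫ ω, f ω ∂P) * starRingEnd ℂ (∫ ω, g ω ∂P) := by
  have hf1 : Integrable f P := hf.integrable one_le_two
  have hg1 : Integrable (fun ω => starRingEnd ℂ (g ω)) P := hg.star.integrable one_le_two
  have hfg : Integrable (fun ω => f ω * starRingEnd ℂ (g ω)) P := hf.integrable_mul hg.star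
  set a := ∫ ω, f ω ∂P with ha
  set b := ∫ ω, g ω ∂P with hb
  have e : ∀ ω, (f ω - a) * starRingEnd ℂ (g ω - b) =
      f ω * starRingEnd ℂ (g ω) - f ω * starRingEnd ℂ b -
        (a * starRingEnd ℂ (g ω) - a * starRingEnd ℂ b) := fun ω => by
    rw [map_sub]
    ring
  have hc : Integrable (fun _ : Ω => a * starRingEnd ℂ b) P := integrable_const _
  rw [ccov, ← ha, ← hb]
  simp_rw [e]
  have hfb : Integrable (fun ω => f ω * starRingEnd ℂ b) P := hf1.mul_const _
  have hag : Integrable (fun ω => a * starRingEnd ℂ (g ω)) P := hg1.const_mul _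
  have h1 : Integrable (fun ω => f ω * starRingEnd ℂ (g ω) - f ω * starRingEnd ℂ b) P :=
    hfg.sub hfb
  have h2 : Integrable (fun ω => a * starRingEnd ℂ (g ω) - a * starRingEnd ℂ b) P := hag.sub hc
  rw [integral_sub h1 h2, integral_sub hfg hfb, integral_sub hag hc, integral_mul_const,
    integral_const_mul, integral_conj, integral_const, ← ha, ← hb]
  simp

theorem ccov_const_mul (c d : ℂ) (f g : Ω → ℂ) :
    ccov P (fun ω => c * f ω) (fun ω => d * g ω) = c * starRingEnd ℂ d * ccov P f g := by
  simp only [ccov]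
  rw [integral_const_mul c, integral_const_mul d, ← integral_const_mul (c * starRingEnd ℂ d)]
  refine integral_congr_ae (ae_of_all _ fun ω => ?_)
  simp only [map_sub, map_mul]
  ring

theorem sampledCov_eq (hα₁ : 1 < α.1) (hα₂ : 1 < α.2) (m τ : ℤ × ℤ) :
    sampledCov P α X m τ =
      ((α.1 ^ ((2 * m.1 + τ.1) * H.1) * α.2 ^ ((2 * m.2 + τ.2) * H.2) : ℝ) : ℂ) *
        ccov P (lampertiInv α H X m) (lampertiInv α H X (m + τ)) := by
  have hX : ∀ n : ℤ × ℤ, X (samplePoint α n) =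
      fun ω => ((scaleFactor α H n : ℝ) : ℂ) * lampertiInv α H X n ω := fun n => by
    funext ω
    have h : ((scaleFactor α H n : ℝ) : ℂ) * ((scaleFactor α H (-n) : ℝ) : ℂ) = 1 := by
      exact_mod_cast scaleFactor_mul_neg hα₁ hα₂ H n
    rw [lampertiInv, ← mul_assoc, h, one_mul]
  have hs : α.1 ^ ((2 * m.1 + τ.1) * H.1) * α.2 ^ ((2 * m.2 + τ.2) * H.2) =
      scaleFactor α H m * scaleFactor α H (m + τ) := by
    rw [← scaleFactor_add hα₁ hα₂, scaleFactor]
    push_cast [Prod.fst_add, Prod.snd_add]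
    ring_nf
  rw [sampledCov, hX m, hX (m + τ), ccov_const_mul, hs, Complex.conj_ofReal]
  push_cast
  rfl

theorem ccov_lampertiInv_add [IsProbabilityMeasure P] (hα₁ : 1 < α.1) (hα₂ : 1 < α.2) {q : ℕ × ℕ}
    (hX : ScalesBy P T H (α.1 ^ q.1, α.2 ^ q.2) X) (hX' : ∀ t ∈ T, MemLp (X t) 2 P) {n m : ℤ × ℤ}
    (hn : samplePoint α n ∈ T)
    (hm : samplePoint α m ∈ T) (hn' : samplePoint α (n + ((q.1 : ℤ), (q.2 : ℤ))) ∈ T)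
    (hm' : samplePoint α (m + ((q.1 : ℤ), (q.2 : ℤ))) ∈ T) :
    ccov P (lampertiInv α H X (n + ((q.1 : ℤ), (q.2 : ℤ))))
        (lampertiInv α H X (m + ((q.1 : ℤ), (q.2 : ℤ)))) =
      ccov P (lampertiInv α H X n) (lampertiInv α H X m) := by
  have hL : ∀ k, samplePoint α k ∈ T → MemLp (lampertiInv α H X k) 2 P := fun k hk =>
    (hX' _ hk).const_mul _
  rw [ccov_eq_sub (hL _ hn') (hL _ hm'), ccov_eq_sub (hL _ hn) (hL _ hm),
    moment_lampertiInv_add hα₁ hα₂ hX hn hm hn' hm', integral_lampertiInv_add hα₁ hα₂ hX hn hn',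
    integral_lampertiInv_add hα₁ hα₂ hX hm hm']

end Moments

/-! ### Spectral random measures of the field -/

section Field

variable {Ω : Type*} [MeasurableSpace Ω]

theorem exists_spectralRandomMeasure {P : Measure Ω} {U : ℕ × ℕ} (hU₁ : 0 < U.1) (hU₂ : 0 < U.2)
    {y : ℤ × ℤ → Lp ℂ 2 P}
    (h1 : ∀ n m, inner ℂ (y (n + periodMul U (1, 0))) (y (m + periodMul U (1, 0))) =
      inner ℂ (y n) (y m))
    (h2 : ∀ n m, inner ℂ (y (n + periodMul U (0, 1))) (y (m + periodMul U (0, 1))) =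
      inner ℂ (y n) (y m)) :
    ∃ φ : VectorMeasure (ℝ × ℝ) (Lp ℂ 2 P), IsSpectralRandomMeasure P U φ ∧
      ∀ n, HasIntegralOn φ square (wave (-n)) (y n) := by
  obtain ⟨φ, hφ, ⟨F, hF1, hF2⟩, hφ2⟩ := exists_harmonic_measure hU₁ hU₂ h1 h2
  refine ⟨φ, ⟨hφ, F, fun A B hA hB => ?_, hF2⟩, hφ2⟩
  rw [hF1 A B hA hB, L2.inner_def]
  rfl

variable {P : Measure Ω} {α H : ℝ × ℝ} {U : ℕ × ℕ} {X : ℝ × ℝ → Ω → ℂ}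

theorem scalesBy_fst {T : Set (ℝ × ℝ)} (hX : IsMSI P T H (α.1 ^ U.1, α.2 ^ U.2) X) :
    ScalesBy P T H (α.1 ^ (U.1, 0).1, α.2 ^ (U.1, 0).2) X := by
  simpa using hX.scale_fst

theorem scalesBy_snd {T : Set (ℝ × ℝ)} (hX : IsMSI P T H (α.1 ^ U.1, α.2 ^ U.2) X) :
    ScalesBy P T H (α.1 ^ (0, U.2).1, α.2 ^ (0, U.2).2) X := by
  simpa using hX.scale_snd

theorem periodMul_one_zero (U : ℕ × ℕ) :
    periodMul U (1, 0) = ((((U.1, 0) : ℕ × ℕ).1 : ℤ), (((U.1, 0) : ℕ × ℕ).2 : ℤ)) := by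
  simp [periodMul]

theorem periodMul_zero_one (U : ℕ × ℕ) :
    periodMul U (0, 1) = ((((0, U.2) : ℕ × ℕ).1 : ℤ), (((0, U.2) : ℕ × ℕ).2 : ℤ)) := by
  simp [periodMul]

theorem harmonicRepr_of_hasIntegralOn (hα₁ : 1 < α.1) (hα₂ : 1 < α.2) {N : Set (ℤ × ℤ)}
    {φ : VectorMeasure (ℝ × ℝ) (Lp ℂ 2 P)} {y : ℤ × ℤ → Lp ℂ 2 P} {Z : ℤ × ℤ → Ω → ℂ}
    (hφ : ∀ n, HasIntegralOn φ square (wave (-n)) (y n))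
    (hy : ∀ n ∈ N, y n =ᵐ[P] fun ω => ((scaleFactor α H (-n) : ℝ) : ℂ) * Z n ω) :
    HarmonicRepr P α H N Z φ := fun n hn => ⟨y n, hφ n, by
  have h : ((scaleFactor α H n : ℝ) : ℂ) * ((scaleFactor α H (-n) : ℝ) : ℂ) = 1 := by
    exact_mod_cast scaleFactor_mul_neg hα₁ hα₂ H n
  filter_upwards [hy n hn] with ω hω
  rw [hω, ← mul_assoc, h, one_mul]⟩

theorem inner_toLp_eq_moment {f g : Ω → ℂ} (hf : MemLp f 2 P) (hg : MemLp g 2 P) :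
    inner ℂ (hf.toLp f) (hg.toLp g) = ∫ ω, g ω * starRingEnd ℂ (f ω) ∂P := by
  rw [inner_toLp_toLp]
  simp_rw [mul_comm]

theorem exists_harmonicRepr_lattice (hα₁ : 1 < α.1) (hα₂ : 1 < α.2) (hU₁ : 0 < U.1)
    (hU₂ : 0 < U.2) (hX : IsMSI P (samplePoint α '' Set.univ) H (α.1 ^ U.1, α.2 ^ U.2) X) :
    ∃ φ : VectorMeasure (ℝ × ℝ) (Lp ℂ 2 P), IsSpectralRandomMeasure P U φ ∧
      HarmonicRepr P α H Set.univ (fun n => X (samplePoint α n)) φ := by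
  have hT : ∀ n, samplePoint α n ∈ samplePoint α '' Set.univ := fun n => ⟨n, trivial, rfl⟩
  have hL : ∀ n, MemLp (lampertiInv α H X n) 2 P := fun n => (hX.memLp _ (hT n)).const_mul _
  obtain ⟨φ, hφ1, hφ2⟩ := exists_spectralRandomMeasure (y := fun n => (hL n).toLp _) hU₁ hU₂
    (fun n m => by
      rw [inner_toLp_eq_moment, inner_toLp_eq_moment, periodMul_one_zero]
      exact moment_lampertiInv_add hα₁ hα₂ (scalesBy_fst hX) (hT _) (hT _) (hT _) (hT _))
    (fun n m => by
      rw [inner_toLp_eq_moment, inner_toLp_eq_moment, periodMul_zero_one]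
      exact moment_lampertiInv_add hα₁ hα₂ (scalesBy_snd hX) (hT _) (hT _) (hT _) (hT _))
  exact ⟨φ, hφ1, harmonicRepr_of_hasIntegralOn hα₁ hα₂ hφ2 fun n _ => (hL n).coeFn_toLp⟩

theorem integral_comp_fst {β : Type*} [MeasurableSpace β] {Q : Measure β} [SFinite P]
    [IsProbabilityMeasure Q] (f : Ω → ℂ) : ∫ x, f x.1 ∂(P.prod Q) = ∫ ω, f ω ∂P := by
  have := integral_prod_mul (μ := P) (ν := Q) f fun _ => (1 : ℂ)
  simpa using this

theorem exists_harmonicRepr_quadrant [IsProbabilityMeasure P] (hα₁ : 1 < α.1) (hα₂ : 1 < α.2)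
    (hU₁ : 0 < U.1) (hU₂ : 0 < U.2)
    (hX : IsMSI P (samplePoint α '' {n | 0 ≤ n.1 ∧ 0 ≤ n.2}) H (α.1 ^ U.1, α.2 ^ U.2) X) :
    ∃ φ : VectorMeasure (ℝ × ℝ) (Lp ℂ 2 (P.prod (volume : Measure unitInterval))),
      IsSpectralRandomMeasure (P.prod (volume : Measure unitInterval)) U φ ∧
      HarmonicRepr (P.prod (volume : Measure unitInterval)) α H {n | 0 ≤ n.1 ∧ 0 ≤ n.2}
        (fun n ω => X (samplePoint α n) ω.1) φ := by
  have hT : ∀ n : ℤ × ℤ, 0 ≤ n → samplePoint α n ∈ samplePoint α '' {n | 0 ≤ n.1 ∧ 0 ≤ n.2} :=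
    fun n hn => ⟨n, hn, rfl⟩
  have hL : ∀ n : ℤ × ℤ, 0 ≤ n → MemLp (fun x : Ω × unitInterval => lampertiInv α H X n x.1) 2
      (P.prod volume) := fun n hn =>
    ((hX.memLp _ (hT n hn)).const_mul _).comp_measurePreserving measurePreserving_fst
  let Y : ℤ × ℤ → Lp ℂ 2 (P.prod (volume : Measure unitInterval)) := fun n =>
    if hn : 0 ≤ n then (hL n hn).toLp _ else 0
  have hY : ∀ n (hn : 0 ≤ n), Y n = (hL n hn).toLp _ := fun n hn => dif_pos hn
  have hmom : ∀ n m, 0 ≤ n → 0 ≤ m → inner ℂ (Y n) (Y m) =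
      ∫ ω, lampertiInv α H X m ω * starRingEnd ℂ (lampertiInv α H X n ω) ∂P :=
    fun n m hn hm => by
      rw [hY n hn, hY m hm, inner_toLp_eq_moment]
      exact integral_comp_fst fun ω =>
        lampertiInv α H X m ω * starRingEnd ℂ (lampertiInv α H X n ω)
  have hp1 : (0 : ℤ × ℤ) ≤ periodMul U (1, 0) := by simp [periodMul, Prod.le_def]
  have hp2 : (0 : ℤ × ℤ) ≤ periodMul U (0, 1) := by simp [periodMul, Prod.le_def]
  obtain ⟨y, hy, h1, h2⟩ := exists_lattice_extension hU₁ hU₂ (Y := Y)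
    (fun n m hn hm => by
      rw [hmom _ _ (add_nonneg hn hp1) (add_nonneg hm hp1), hmom _ _ hn hm]
      have e1 := hT _ (add_nonneg hn hp1)
      have e2 := hT _ (add_nonneg hm hp1)
      rw [periodMul_one_zero] at e1 e2 ⊢
      exact moment_lampertiInv_add hα₁ hα₂ (scalesBy_fst hX) (hT _ hm) (hT _ hn) e2 e1)
    (fun n m hn hm => by
      rw [hmom _ _ (add_nonneg hn hp2) (add_nonneg hm hp2), hmom _ _ hn hm]
      have e1 := hT _ (add_nonneg hn hp2)
      have e2 := hT _ (add_nonneg hm hp2)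
      rw [periodMul_zero_one] at e1 e2 ⊢
      exact moment_lampertiInv_add hα₁ hα₂ (scalesBy_snd hX) (hT _ hm) (hT _ hn) e2 e1)
    (orthonormal_uniformWave P) (fun k n hn => by
      rw [hY n hn]
      exact inner_uniformWave_comp_fst P k (hL n hn))
  obtain ⟨φ, hφ1, hφ2⟩ := exists_spectralRandomMeasure hU₁ hU₂ h1 h2
  refine ⟨φ, hφ1, harmonicRepr_of_hasIntegralOn hα₁ hα₂ hφ2 fun n hn => ?_⟩
  rw [hy n hn, hY n hn]
  exact (hL n hn).coeFn_toLp

end Field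

/-! ### Fourier inversion on the box -/

theorem boxChar_add (U : ℕ × ℕ) (m n j : ℤ × ℤ) :
    boxChar U (m + n) j = boxChar U m j * boxChar U n j := by
  rw [boxChar, boxChar, boxChar, ← Complex.exp_add]
  congr 1
  push_cast [Prod.fst_add, Prod.snd_add]
  ring

theorem boxChar_periodMul {U : ℕ × ℕ} (hU₁ : 0 < U.1) (hU₂ : 0 < U.2) (k j : ℤ × ℤ) :
    boxChar U (periodMul U k) j = 1 := by
  have h1 : (U.1 : ℂ) ≠ 0 := by exact_mod_cast hU₁.ne'
  have h2 : (U.2 : ℂ) ≠ 0 := by exact_mod_cast hU₂.ne'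
  refine Complex.exp_eq_one_iff.2 ⟨k.1 * j.1 + k.2 * j.2, ?_⟩
  simp only [periodMul]
  push_cast
  field_simp

/-- Fourier inversion on ℤ/U₁ × ℤ/U₂. The characters depend only on residues, so an arbitrary m
returns the value at its representative in the box. -/
theorem sum_boxChar_mul_auxR {U : ℕ × ℕ} (hU₁ : 0 < U.1) (hU₂ : 0 < U.2)
    (Q : ℤ × ℤ → ℤ × ℤ → ℂ) (m τ : ℤ × ℤ) :
    ∑ j ∈ box U, boxChar U (-m) j * auxR U Q j τ = Q (boxMod U m) τ := by
  have hU : (U.1 : ℂ) * U.2 ≠ 0 :=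
    mul_ne_zero (by exact_mod_cast hU₁.ne') (by exact_mod_cast hU₂.ne')
  have hm := boxMod_mem hU₁ hU₂ m
  have hchar : ∀ n j, boxChar U (-m) j * boxChar U n j = boxChar U (n - boxMod U m) j :=
    fun n j => by
      rw [← boxChar_add, ← mul_one (boxChar U (-m + n) j),
        ← boxChar_periodMul hU₁ hU₂ (boxDiv U m) j, ← boxChar_add]
      congr 1
      nth_rewrite 1 [← boxMod_add_periodMul U m]
      abel
  calc ∑ j ∈ box U, boxChar U (-m) j * auxR U Q j τ
      = ∑ n ∈ box U, (1 / ((U.1 : ℂ) * U.2) * Q n τ) *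
          ∑ j ∈ box U, boxChar U (n - boxMod U m) j := by
        simp only [auxR, Finset.mul_sum]
        rw [Finset.sum_comm]
        refine Finset.sum_congr rfl fun n _ => Finset.sum_congr rfl fun j _ => ?_
        rw [← hchar]
        ring
    _ = ∑ n ∈ box U, if n = boxMod U m then Q n τ else 0 := by
        refine Finset.sum_congr rfl fun n hn => ?_
        rw [sum_boxChar_sub hn hm]
        split_ifs
        · rw [mul_right_comm, one_div, inv_mul_cancel₀ hU, one_mul]
        · rw [mul_zero]
    _ = Q (boxMod U m) τ := by rw [Finset.sum_ite_eq', if_pos hm]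

theorem boxMod_of_mem {U : ℕ × ℕ} {n : ℤ × ℤ} (hn : n ∈ box U) : boxMod U n = n := by
  rw [mem_box] at hn
  exact Prod.ext (Int.emod_eq_of_lt hn.1.1 hn.1.2) (Int.emod_eq_of_lt hn.2.1 hn.2.2)

/-! ### Orthogonality of the waves on the square -/

theorem integral_Icc_exp (d : ℤ) :
    ∫ x in Set.Icc 0 (2 * Real.pi), Complex.exp (Complex.I * (d * (x : ℂ))) =
      if d = 0 then 2 * (Real.pi : ℂ) else 0 := by
  have hpi : (0 : ℝ) ≤ 2 * Real.pi := by positivity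
  rw [integral_Icc_eq_integral_Ioc, ← intervalIntegral.integral_of_le hpi]
  split_ifs with h
  · simp [h]
  · have hc : Complex.I * d ≠ 0 := mul_ne_zero Complex.I_ne_zero (by exact_mod_cast h)
    simp_rw [← mul_assoc]
    rw [integral_exp_mul_complex hc]
    have : Complex.I * d * ((2 * Real.pi : ℝ) : ℂ) = d * (2 * Real.pi * Complex.I) := by
      push_cast
      ring
    rw [this, Complex.exp_int_mul_two_pi_mul_I]
    simp

theorem integral_square_wave (d : ℤ × ℤ) :
    ∫ l in square, wave d l = if d = 0 then 4 * (Real.pi : ℂ) ^ 2 else 0 := by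
  have h : ∀ l : ℝ × ℝ, wave d l = Complex.exp (Complex.I * (d.1 * (l.1 : ℂ))) *
      Complex.exp (Complex.I * (d.2 * (l.2 : ℂ))) := fun l => by
    rw [wave, mul_add, Complex.exp_add]
  simp_rw [h]
  rw [square, Measure.volume_eq_prod, setIntegral_prod_mul
    (fun x : ℝ => Complex.exp (Complex.I * (d.1 * (x : ℂ))))
    (fun x : ℝ => Complex.exp (Complex.I * (d.2 * (x : ℂ)))), integral_Icc_exp, integral_Icc_exp]
  by_cases h1 : d.1 = 0 <;> by_cases h2 : d.2 = 0 <;> simp [h1, h2, Prod.ext_iff]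
  ring

/-- The density is a trigonometric polynomial with frequencies in the box, so orthogonality reads
off its coefficient at τ. -/
theorem integral_wave_mul_spectralDensity {U : ℕ × ℕ} (Q : ℤ × ℤ → ℤ × ℤ → ℂ) (j : ℤ × ℤ)
    {τ : ℤ × ℤ} (hτ : τ ∈ box U) :
    ∫ l in square, wave (-τ) l * spectralDensity U Q j l = auxR U Q j τ := by
  have hpi : (4 * (Real.pi : ℂ) ^ 2) ≠ 0 := by
    have : (Real.pi : ℂ) ≠ 0 := by exact_mod_cast Real.pi_ne_zero
    exact mul_ne_zero (by norm_num) (pow_ne_zero 2 this)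
  have h : ∀ l, wave (-τ) l * spectralDensity U Q j l =
      ∑ σ ∈ box U, (1 / (4 * (Real.pi : ℂ) ^ 2) * auxR U Q j σ) * wave (σ - τ) l := fun l => by
    rw [spectralDensity, Finset.mul_sum, Finset.mul_sum]
    refine Finset.sum_congr rfl fun σ _ => ?_
    rw [sub_eq_neg_add, wave_add]
    ring
  simp_rw [h]
  rw [integral_finsetSum _ fun σ _ =>
    ((continuous_wave (σ - τ)).continuousOn.integrableOn_compact isCompact_square).const_mul _]
  simp_rw [integral_const_mul, integral_square_wave]
  rw [Finset.sum_eq_single τ (fun σ _ hσ => by rw [if_neg (sub_ne_zero.2 hσ), mul_zero])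
    (fun h => absurd hτ h), sub_self, if_pos rfl]
  field_simp

/-! ### The periodic covariance of the transformed field -/

section Covariance

variable {Ω : Type*} [MeasurableSpace Ω] {P : Measure Ω} [IsProbabilityMeasure P]
  {α H : ℝ × ℝ} {U : ℕ × ℕ} {X : ℝ × ℝ → Ω → ℂ}

/-- The shift e may have mixed signs, and passing from n to m directly could leave the quadrant.
Both pairs are instead moved upwards to a common one, n + e⁺U = m + e⁻U. -/
theorem ccov_lampertiInv_congr (hα₁ : 1 < α.1) (hα₂ : 1 < α.2)
    (hX : IsMSI P (samplePoint α '' {n | 0 ≤ n.1 ∧ 0 ≤ n.2}) H (α.1 ^ U.1, α.2 ^ U.2) X)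
    {n m τ e : ℤ × ℤ} (hn : 0 ≤ n) (hnτ : 0 ≤ n + τ) (hm : 0 ≤ m) (hmτ : 0 ≤ m + τ)
    (he : m = n + periodMul U e) :
    ccov P (lampertiInv α H X n) (lampertiInv α H X (n + τ)) =
      ccov P (lampertiInv α H X m) (lampertiInv α H X (m + τ)) := by
  have hT : ∀ n : ℤ × ℤ, 0 ≤ n → samplePoint α n ∈ samplePoint α '' {n | 0 ≤ n.1 ∧ 0 ≤ n.2} :=
    fun n hn => ⟨n, hn, rfl⟩
  have hp1 : (0 : ℤ × ℤ) ≤ periodMul U (1, 0) := by simp [periodMul, Prod.le_def]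
  have hp2 : (0 : ℤ × ℤ) ≤ periodMul U (0, 1) := by simp [periodMul, Prod.le_def]
  have hstep := @kernel_add_periodMul_of_nonneg U
    (fun n m => ccov P (lampertiInv α H X n) (lampertiInv α H X m))
    (fun n m hn hm => by
      have e1 := hT _ (add_nonneg hn hp1)
      have e2 := hT _ (add_nonneg hm hp1)
      rw [periodMul_one_zero] at e1 e2 ⊢
      exact ccov_lampertiInv_add hα₁ hα₂ (scalesBy_fst hX) hX.memLp (hT _ hn) (hT _ hm) e1 e2)
    (fun n m hn hm => by
      have e1 := hT _ (add_nonneg hn hp2)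
      have e2 := hT _ (add_nonneg hm hp2)
      rw [periodMul_zero_one] at e1 e2 ⊢
      exact ccov_lampertiInv_add hα₁ hα₂ (scalesBy_snd hX) hX.memLp (hT _ hn) (hT _ hm) e1 e2)
  have h1 := hstep hn hnτ e.1.toNat e.2.toNat
  have h2 := hstep hm hmτ (-e.1).toNat (-e.2).toNat
  have hsplit : e + ((((-e.1).toNat : ℕ) : ℤ), (((-e.2).toNat : ℕ) : ℤ)) =
      (((e.1.toNat : ℕ) : ℤ), ((e.2.toNat : ℕ) : ℤ)) := by
    ext
    · simp only [Prod.fst_add]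
      omega
    · simp only [Prod.snd_add]
      omega
  have hsh : m + periodMul U ((((-e.1).toNat : ℕ) : ℤ), (((-e.2).toNat : ℕ) : ℤ)) =
      n + periodMul U (((e.1.toNat : ℕ) : ℤ), ((e.2.toNat : ℕ) : ℤ)) := by
    rw [he, add_assoc, ← periodMul_add, hsplit]
  rw [← h1, ← h2, add_right_comm n τ, add_right_comm m τ, hsh]

theorem periodicCov_lampertiInv_boxMod (hα₁ : 1 < α.1) (hα₂ : 1 < α.2) (hU₁ : 0 < U.1)
    (hU₂ : 0 < U.2)
    (hX : IsMSI P (samplePoint α '' {n | 0 ≤ n.1 ∧ 0 ≤ n.2}) H (α.1 ^ U.1, α.2 ^ U.2) X)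
    {m τ : ℤ × ℤ} (hm : 0 ≤ m) (hmτ : 0 ≤ m + τ) :
    periodicCov P U (lampertiInv α H X) (boxMod U m) τ =
      ccov P (lampertiInv α H X m) (lampertiInv α H X (m + τ)) := by
  have hr := mem_box.1 (boxMod_mem hU₁ hU₂ m)
  -- Since N ≥ 1, adding (-t)⁺ periods compensates a negative lag t.
  have key : ∀ (a t : ℤ) (N : ℕ), 0 < N → 0 ≤ a → 0 ≤ a + max (-t) 0 * N ∧
      0 ≤ a + max (-t) 0 * N + t := fun a t N hN ha => by
    have h0 : 0 ≤ max (-t) 0 := le_max_right _ _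
    have h1 : max (-t) 0 ≤ max (-t) 0 * N := by nlinarith
    have h2 : -t ≤ max (-t) 0 := le_max_left _ _
    constructor <;> linarith
  have k1 := key (boxMod U m).1 τ.1 U.1 hU₁ hr.1.1
  have k2 := key (boxMod U m).2 τ.2 U.2 hU₂ hr.2.1
  refine ccov_lampertiInv_congr hα₁ hα₂ hX (n := boxMod U m + periodShift U τ)
    (e := boxDiv U m - (max (-τ.1) 0, max (-τ.2) 0)) ⟨k1.1, k2.1⟩ ⟨k1.2, k2.2⟩ hm hmτ ?_
  have hs : periodShift U τ = periodMul U (max (-τ.1) 0, max (-τ.2) 0) := rfl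
  rw [hs, add_assoc, ← periodMul_add, add_sub_cancel, boxMod_add_periodMul]

end Covariance

end MSI

end

/-! ### Harmonic representation, covariance and spectral density of the sampled field. -/

theorem proposition2 {Ω : Type*} [MeasurableSpace Ω] (P : Measure Ω) [IsProbabilityMeasure P]
    (α H : ℝ × ℝ) (U : ℕ × ℕ) (hα₁ : 1 < α.1) (hα₂ : 1 < α.2) (hU₁ : 0 < U.1) (hU₂ : 0 < U.2)
    (X : ℝ × ℝ → Ω → ℂ)
    (hX : MSI.IsMSI P (MSI.samplePoint α '' {n : ℤ × ℤ | 0 ≤ n.1 ∧ 0 ≤ n.2}) H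
      (α.1 ^ U.1, α.2 ^ U.2) X) :
    -- (i), on the probability space enlarged by an independent uniform variable
    (∃ φ : VectorMeasure (ℝ × ℝ) (Lp ℂ 2 (P.prod (volume : Measure unitInterval))),
      MSI.IsSpectralRandomMeasure (P.prod (volume : Measure unitInterval)) U φ ∧
      MSI.HarmonicRepr (P.prod (volume : Measure unitInterval)) α H
        {n : ℤ × ℤ | 0 ≤ n.1 ∧ 0 ≤ n.2} (fun n ω => X (MSI.samplePoint α n) ω.1) φ) ∧
    -- (i), on the given probability space, if the field is MSI on the whole lattice of samples
    (MSI.IsMSI P (MSI.samplePoint α '' Set.univ) H (α.1 ^ U.1, α.2 ^ U.2) X →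
      ∃ φ : VectorMeasure (ℝ × ℝ) (Lp ℂ 2 P), MSI.IsSpectralRandomMeasure P U φ ∧
        MSI.HarmonicRepr P α H Set.univ (fun n => X (MSI.samplePoint α n)) φ) ∧
    -- (ii)
    (∀ m τ : ℤ × ℤ, 0 ≤ m.1 → 0 ≤ m.2 → 0 ≤ m.1 + τ.1 → 0 ≤ m.2 + τ.2 →
      MSI.sampledCov P α X m τ =
        ((α.1 ^ ((2 * m.1 + τ.1) * H.1) * α.2 ^ ((2 * m.2 + τ.2) * H.2) : ℝ) : ℂ) *
          ∑ j ∈ MSI.box U, MSI.boxChar U (-m) j *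
            MSI.auxR U (MSI.periodicCov P U (MSI.lampertiInv α H X)) j τ) ∧
    -- (iii)
    (∀ j ∈ MSI.box U, ∀ l : ℝ × ℝ,
      MSI.spectralDensity U (MSI.sampledCov P α X) j l =
        1 / (2 * (Real.pi : ℂ)) ^ 2 * ∑ τ ∈ MSI.box U, MSI.wave τ l *
          (1 / ((U.1 : ℂ) * U.2) * ∑ n ∈ MSI.box U, MSI.boxChar U n j *
            (((α.1 ^ ((2 * n.1 + τ.1) * H.1) * α.2 ^ ((2 * n.2 + τ.2) * H.2) : ℝ) : ℂ) *
              MSI.ccov P (MSI.lampertiInv α H X n) (MSI.lampertiInv α H X (n + τ))))) ∧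
    -- (iii), the density recovers the covariances
    (∀ n ∈ MSI.box U, ∀ τ ∈ MSI.box U,
      MSI.sampledCov P α X n τ = ∑ j ∈ MSI.box U, MSI.boxChar U (-n) j *
        ∫ l in MSI.square,
          MSI.wave (-τ) l * MSI.spectralDensity U (MSI.sampledCov P α X) j l) := by
  refine ⟨MSI.exists_harmonicRepr_quadrant hα₁ hα₂ hU₁ hU₂ hX,
    fun hX' => MSI.exists_harmonicRepr_lattice hα₁ hα₂ hU₁ hU₂ hX', fun m τ h1 h2 h3 h4 => ?_,
    fun j _ l => ?_, fun n hn τ hτ => ?_⟩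
  -- Inversion yields the periodic covariance at the residue of m, and periodicity moves it back to
  -- m.
  · rw [MSI.sampledCov_eq hα₁ hα₂, MSI.sum_boxChar_mul_auxR hU₁ hU₂,
      MSI.periodicCov_lampertiInv_boxMod hα₁ hα₂ hU₁ hU₂ hX ⟨h1, h2⟩ ⟨h3, h4⟩]
  · simp only [MSI.spectralDensity, MSI.auxR, MSI.sampledCov_eq (H := H) hα₁ hα₂]
    rw [mul_pow]
    norm_num
  · rw [Finset.sum_congr rfl fun j _ => by rw [MSI.integral_wave_mul_spectralDensity _ j hτ],
      MSI.sum_boxChar_mul_auxR hU₁ hU₂, MSI.boxMod_of_mem hn]
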